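/- Let $\mathcal K$ be an augmented virtual double category: it consists of a category of objects and vertical morphisms, of horizontal morphisms $J\colon A\nrightarrow B$, and of cells $\phi\colon (J_1,\dots,J_n)\Rightarrow \underline L$ with a vertical source $f$ and a vertical target $g$, whose horizontal source is a (possibly empty) path and whose horizontal target $\underline L$ is a path of length at most one, with unital associative compositions $\psi\circ(\phi_1,\dots,\phi_n)$. A cell is *nullary* if $\underline L$ is empty, *unary* if $\underline L$ has length one, and *vertical* if both its horizontal source and its horizontal target are empty. Write $V(\mathcal K)$ for the $2$-category of objects, vertical morphisms and vertical cells of $\mathcal K$, and $\phi\odot\psi$ for the horizontal composite of two cells of which at most one is unary. *Cartesian cells.* A cell $\psi\colon \underline J\Rightarrow\underline L$ with $|\underline J|\le 1$, vertical source $f$ and vertical target $g$ is cartesian if every cell with horizontal target $\underline L$, vertical source $f\circ h$ and vertical target $g\circ k$ factors uniquely as $\psi\circ\phi$ with $\phi$ of vertical source $h$ and vertical target $k$. If $\underline J=(J')$ and $\underline L=(L)$, it defines $J'$ as the restriction $L(f,g)$. $\mathcal K$ *has restrictions on the right* if the restriction $J(\mathrm{id},g)$ exists for every $J\colon A\nrightarrow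 B$ and every $g\colon Y\to B$. A *companion* of $j\colon A\to B$ is a horizontal morphism $j_*\colon A\nrightarrow B$ with a cartesian nullary cell $\mathrm{cart}\colon j_*\Rightarrow B$ of vertical source $j$ and vertical target $\mathrm{id}_B$; $\mathrm{cocart}\colon A\Rightarrow j_*$ denotes the unique cell, with vertical source $\mathrm{id}_A$ and vertical target $j$, such that $\mathrm{cart}\circ\mathrm{cocart}=\mathrm{id}_j$. *Tabulations.* A tabulation of $J\colon A\nrightarrow B$ is an object $T$ with a cell $\pi$ of empty horizontal source at $T$, horizontal target $J$, and vertical source $\pi_A\colon T\to A$ and vertical target $\pi_B\colon T\to B$, such that (1) every cell $\phi$ of empty horizontal source at an object $X$ and horizontal target $J$ is $\pi\circ\phi'$ for a unique morphism $\phi'\colon X\to T$; (2) for $\phi=\pi\circ\phi'$ and $\psi=\pi\circ\psi'$, and for nullary cells $\xi_A,\xi_B$ with the same horizontal source $\underline H$, from $\pi_A\circ\phi'$ to $\pi_A\circ\psi'$ and from $\pi_B\circ\phi'$ to $\pi_B\circ\psi'$ respectively, with $\xi_A\odot\psi=\phi\odot\xi_B$, there is a unique nullary cell $\xi'\colon\underline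 H\Rightarrow T$, from $\phi'$ to $\psi'$, with $\pi_A\circ\xi'=\xi_A$ and $\pi_B\circ\xi'=\xi_B$. A path of cells is *weakly nullary-cocartesian* if every nullary cell, with the same horizontal source and with vertical source and target factoring through those of the path, factors uniquely through it; a weakly nullary-cocartesian path $\underline\phi$ with vertical source $f_0$ is *left nullary-cocartesian* if moreover, for every path $(K_1,\dots,K_p)$ with $p\ge1$ such that $K_p(\mathrm{id},f_0)$ exists, the path $(\mathrm{id}_{K_1},\dots,\mathrm{id}_{K_{p-1}},\mathrm{cart})^\frown\underline\phi$ is weakly nullary-cocartesian, where $\mathrm{cart}$ defines $K_p(\mathrm{id},f_0)$. $\mathcal K$ *has left nullary-cocartesian tabulations* if every horizontal morphism has a tabulation whose defining cell $\pi$ is left nullary-cocartesian. *Kan extensions in $\mathcal K$.* A nullary cell $\eta\colon\underline J\Rightarrow M$ with vertical source $d$ and vertical target $l$ is *left Kan* if for every path $\underline H$ every nullary cell $\phi\colon\underline J{}^\frown\underline H\Rightarrow M$ with vertical source $d$ factors uniquely as $\phi=\eta\odot\phi'$ with $\phi'\colon\underline H\Rightarrow M$ nullary with vertical source $l$. If $\underline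 J=(J_1,\dots,J_n)$ with $n\ge1$, it is *pointwise left Kan* if it is left Kan and, for every $f$ such that $J_n(\mathrm{id},f)$ exists, the composite $\eta\circ(\mathrm{id}_{J_1},\dots,\mathrm{id}_{J_{n-1}},\mathrm{cart})$ is left Kan, where $\mathrm{cart}$ defines $J_n(\mathrm{id},f)$. *Kan extensions in a $2$-category (Street).* A cell $\eta\colon d\Rightarrow l\circ j$ exhibits $l$ as the pointwise left Kan extension of $d$ along $j\colon A\to B$ if for every morphism $f\colon C\to B$ and every comma object $j/f$, with projections $p\colon j/f\to A$ and $q\colon j/f\to C$ and cell $\kappa\colon j\circ p\Rightarrow f\circ q$, the composite $d\circ p\Rightarrow l\circ j\circ p\Rightarrow l\circ f\circ q$ of $\eta\circ p$ and $l\circ\kappa$ exhibits $l\circ f$ as the left Kan extension of $d\circ p$ along $q$. **Proposition.** Assume that $\mathcal K$ has restrictions on the right and left nullary-cocartesian tabulations. Let $j\colon A\to B$, $d\colon A\to M$ and $l\colon B\to M$ be vertical morphisms, let $j_*$ be a companion of $j$, let $\eta\colon d\Rightarrow l\circ j$ be a vertical cell, and let $\eta'\colon j_*\Rightarrow M$ be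 the nullary cell with vertical source $d$ and vertical target $l$ such that $\eta=\eta'\circ\mathrm{cocart}$. Then $\eta$ exhibits $l$ as the pointwise left Kan extension of $d$ along $j$ in the $2$-category $V(\mathcal K)$, in Street's sense, if and only if $\eta'$ is pointwise left Kan in $\mathcal K$. -/

import Mathlib

open CategoryTheory

universe u v w x

set_option linter.checkUnivs false

/-! # Augmented virtual double categories -/

/-- A (possibly empty) path `A = A₀ ⇸ A₁ ⇸ ⋯ ⇸ Aₙ = B` of horizontal morphisms. -/
inductive HPath {K : Type u} (Hor : K → K → Type w) : K → K → Type (max u w)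
  | nil (A : K) : HPath Hor A A
  | cons {A B C : K} (J : Hor A B) (p : HPath Hor B C) : HPath Hor A C

namespace HPath

variable {K : Type u} {Hor : K → K → Type w}

/-- The path of length one. -/
abbrev single {A B : K} (J : Hor A B) : HPath Hor A B := cons J (nil B)

/-- Concatenation of paths. -/
def comp : ∀ {A B C : K}, HPath Hor A B → HPath Hor B C → HPath Hor A C
  | _, _, _, nil _, q => q
  | _, _, _, cons J p, q => cons J (comp p q)

/-- The path `(J₁, …, Jₙ, J)`. -/
abbrev snoc {A B C : K} (p : HPath Hor A B) (J : Hor B C) : HPath Hor A C := p.comp (single J)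

@[simp] theorem nil_comp {A B : K} (p : HPath Hor A B) : (nil A).comp p = p := rfl

@[simp] theorem cons_comp {A B C D : K} (J : Hor A B) (p : HPath Hor B C) (q : HPath Hor C D) :
    (cons J p).comp q = cons J (p.comp q) := rfl

@[simp] theorem comp_nil {A B : K} (p : HPath Hor A B) : p.comp (nil B) = p := by
  induction p with
  | nil => rfl
  | cons J p ih => simp [ih]

@[simp] theorem comp_assoc {A B C D : K} (p : HPath Hor A B) (q : HPath Hor B C)
    (r : HPath Hor C D) : (p.comp q).comp r = p.comp (q.comp r) := by
  induction p with
  | nil => rfl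
  | cons J p ih => simp [ih]

end HPath

/-- A path of horizontal morphisms of length at most one: these are the horizontal targets of
cells. -/
inductive HTarget {K : Type u} (Hor : K → K → Type w) : K → K → Type (max u w)
  | empty (C : K) : HTarget Hor C C
  | single {C D : K} (L : Hor C D) : HTarget Hor C D

/-- The underlying path of a horizontal target. -/
def HTarget.toPath {K : Type u} {Hor : K → K → Type w} :
    ∀ {C D : K}, HTarget Hor C D → HPath Hor C D
  | _, _, .empty C => .nil C
  | _, _, .single L => .single L

/-- The data of an augmented virtual double category, without composition of cells: a category of
objects and vertical morphisms, horizontal morphisms `Hor A B`, cells, and identity cells.  An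
element of `Cell f g J L` is a cell with vertical source `f`, vertical target `g`, horizontal
source the path `J`, and horizontal target `L`; it is *nullary* if `L` is empty, *unary* if `L` is
a single horizontal morphism, and *vertical* if both `J` and `L` are empty. -/
class AugVirtualDoubleStruct (K : Type u) extends Category.{v} K where
  /-- Horizontal morphisms `A ⇸ B`. -/
  Hor : K → K → Type w
  /-- Cells. -/
  Cell : ∀ {A B C D : K}, (A ⟶ C) → (B ⟶ D) → HPath Hor A B → HTarget Hor C D → Type x
  /-- Horizontal identity cells `id_J : J ⇒ J`. -/
  hid : ∀ {A B : K} (J : Hor A B), Cell (𝟙 A) (𝟙 B) (HPath.single J) (HTarget.single J)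
  /-- Vertical identity cells `id_f : A ⇒ C`. -/
  vid : ∀ {A C : K} (f : A ⟶ C), Cell f f (HPath.nil A) (HTarget.empty C)

namespace AVDC

section Paths

variable {K : Type u} [AugVirtualDoubleStruct.{u, v, w, x} K]

/-- Horizontal morphisms `A ⇸ B`. -/
abbrev Hor (A B : K) : Type w := AugVirtualDoubleStruct.Hor A B

/-- Paths of horizontal morphisms. -/
abbrev Path (A B : K) : Type (max u w) := HPath (AugVirtualDoubleStruct.Hor (K := K)) A B

/-- Paths of length at most one. -/
abbrev Target (A B : K) : Type (max u w) := HTarget (AugVirtualDoubleStruct.Hor (K := K)) A B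

/-- Cells. -/
abbrev Cell {A B C D : K} (f : A ⟶ C) (g : B ⟶ D) (J : Path A B) (L : Target C D) : Type x :=
  AugVirtualDoubleStruct.Cell f g J L

/-- Horizontal identity cells. -/
abbrev hid {A B : K} (J : Hor A B) :
    Cell (𝟙 A) (𝟙 B) (HPath.single J) (HTarget.single J) :=
  AugVirtualDoubleStruct.hid J

/-- Vertical identity cells. -/
abbrev vid {A C : K} (f : A ⟶ C) : Cell f f (HPath.nil A) (HTarget.empty C) :=
  AugVirtualDoubleStruct.vid f

/-- The identity cell `id_L` of a path `L` of length at most one: `id_L` if `L` is a horizontal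
morphism, `id_C := id_{𝟙 C}` if `L` is the empty path at `C`. -/
def tid : ∀ {C D : K} (L : Target C D), Cell (𝟙 C) (𝟙 D) L.toPath L
  | _, _, .empty C => vid (𝟙 C)
  | _, _, .single L => hid L

/-- Paths `(φ₁, …, φₙ)` of cells, in which the vertical target of each `φᵢ` is the vertical source
of `φᵢ₊₁`.  Here `f` is the vertical source of `φ₁`, `g` the vertical target of `φₙ`, while `H` and
`J` are the concatenations of the horizontal sources and of the horizontal targets of the `φᵢ`.
The equations in `cons` allow `H` and `J` to be given up to propositional equality. -/
inductive CellPath : ∀ {X Y A B : K}, (X ⟶ A) → (Y ⟶ B) → Path X Y → Path A B →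
    Type (max u v w x)
  | nil {X A : K} (f : X ⟶ A) : CellPath f f (HPath.nil X) (HPath.nil A)
  | cons {X Y Z A B C : K} {f : X ⟶ A} {g : Y ⟶ B} {h : Z ⟶ C}
      {H₁ : Path X Y} {L₁ : Target A B} {H₂ : Path Y Z} {J₂ : Path B C}
      {H : Path X Z} {J : Path A C}
      (φ : Cell f g H₁ L₁) (r : CellPath g h H₂ J₂)
      (eH : H = H₁.comp H₂) (eJ : J = L₁.toPath.comp J₂) : CellPath f h H J

namespace CellPath

/-- The path `(φ)`. -/
def single {X Y A B : K} {f : X ⟶ A} {g : Y ⟶ B} {H : Path X Y} {L : Target A B}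
    (φ : Cell f g H L) : CellPath f g H L.toPath :=
  cons φ (nil g) (by simp) (by simp)

/-- Concatenation of paths of cells. -/
def append : ∀ {X Y Z A B C : K} {f : X ⟶ A} {g : Y ⟶ B} {h : Z ⟶ C}
    {H₁ : Path X Y} {J₁ : Path A B} {H₂ : Path Y Z} {J₂ : Path B C},
    CellPath f g H₁ J₁ → CellPath g h H₂ J₂ → CellPath f h (H₁.comp H₂) (J₁.comp J₂)
  | _, _, _, _, _, _, _, _, _, _, _, _, _, nil _, s => s
  | _, _, _, _, _, _, _, _, _, _, _, _, _, cons φ r eH eJ, s =>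
      cons φ (append r s) (by rw [eH, HPath.comp_assoc]) (by rw [eJ, HPath.comp_assoc])

/-- The path `(id_{J₁}, …, id_{Jₙ})` of identity cells. -/
def ids : ∀ {A B : K} (J : Path A B), CellPath (𝟙 A) (𝟙 B) J J
  | _, _, .nil A => nil (𝟙 A)
  | _, _, .cons J p => cons (L₁ := .single J) (hid J) (ids p) rfl rfl

end CellPath

/-- Two composable rows of cells: a path `(ψ₁, …, ψₙ)` of cells together with, for each `i`, a path
of cells `φᵢ` whose horizontal target is the horizontal source of `ψᵢ`. -/
inductive CellGrid : ∀ {X Y A B C D : K}, (X ⟶ A) → (Y ⟶ B) → (A ⟶ C) → (B ⟶ D) →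
    Path X Y → Path A B → Path C D → Type (max u v w x)
  | nil {X A C : K} (p : X ⟶ A) (f : A ⟶ C) :
      CellGrid p p f f (HPath.nil X) (HPath.nil A) (HPath.nil C)
  | cons {X Y Z A B B' C D E : K} {p : X ⟶ A} {q : Y ⟶ B} {r : Z ⟶ B'}
      {f : A ⟶ C} {g : B ⟶ D} {h : B' ⟶ E}
      {G₁ : Path X Y} {H₁ : Path A B} {L₁ : Target C D}
      {G₂ : Path Y Z} {H₂ : Path B B'} {J₂ : Path D E}
      (ψ : Cell f g H₁ L₁) (φ : CellPath p q G₁ H₁) (rest : CellGrid q r g h G₂ H₂ J₂) :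
      CellGrid p r f h (G₁.comp G₂) (H₁.comp H₂) (L₁.toPath.comp J₂)

namespace CellGrid

/-- The concatenation of the paths `φᵢ`. -/
def top : ∀ {X Y A B C D : K} {p : X ⟶ A} {q : Y ⟶ B} {f : A ⟶ C} {g : B ⟶ D}
    {G : Path X Y} {H : Path A B} {J : Path C D},
    CellGrid p q f g G H J → CellPath p q G H
  | _, _, _, _, _, _, _, _, _, _, _, _, _, nil p _ => .nil p
  | _, _, _, _, _, _, _, _, _, _, _, _, _, cons _ φ rest => φ.append rest.top

/-- The path `(ψ₁, …, ψₙ)`. -/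
def bottom : ∀ {X Y A B C D : K} {p : X ⟶ A} {q : Y ⟶ B} {f : A ⟶ C} {g : B ⟶ D}
    {G : Path X Y} {H : Path A B} {J : Path C D},
    CellGrid p q f g G H J → CellPath f g H J
  | _, _, _, _, _, _, _, _, _, _, _, _, _, nil _ f => .nil f
  | _, _, _, _, _, _, _, _, _, _, _, _, _, cons ψ _ rest => .cons ψ rest.bottom rfl rfl

/-- The path `(ψ₁ ∘ φ₁, …, ψₙ ∘ φₙ)`, formed with respect to a given operation of vertical
composition. -/
def composite
    (comp : ∀ {X Y A B C D : K} {f : X ⟶ A} {g : Y ⟶ B} {h : A ⟶ C} {k : B ⟶ D}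
      {f' : X ⟶ C} {g' : Y ⟶ D} {H : Path X Y} {J : Path A B} {L : Target C D},
      Cell h k J L → CellPath f g H J → f' = f ≫ h → g' = g ≫ k → Cell f' g' H L) :
    ∀ {X Y A B C D : K} {p : X ⟶ A} {q : Y ⟶ B} {f : A ⟶ C} {g : B ⟶ D}
      {G : Path X Y} {H : Path A B} {J : Path C D},
      CellGrid p q f g G H J → CellPath (p ≫ f) (q ≫ g) G J
  | _, _, _, _, _, _, _, _, _, _, _, _, _, nil p f => .nil (p ≫ f)
  | _, _, _, _, _, _, _, _, _, _, _, _, _, cons ψ φ rest =>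
      .cons (comp ψ φ rfl rfl) (composite comp rest) rfl rfl

end CellGrid

end Paths

end AVDC

open AVDC in
/-- An augmented virtual double category.  The vertical composite `ψ ∘ (φ₁, …, φₙ)` is written
`vcomp ψ φ hf hg`; the equations `hf` and `hg` allow its vertical source and vertical target to be
given up to propositional equality.  The composite is allowed for `n = 0` as well, where by
`vcomp_insert` it necessarily equals the composite `ψ ∘ (id_f)` with a vertical identity cell. -/
class AugVirtualDoubleCategory (K : Type u) extends AugVirtualDoubleStruct.{u, v, w, x} K where
  /-- Vertical composition. -/
  vcomp : ∀ {X Y A B C D : K} {f : X ⟶ A} {g : Y ⟶ B} {h : A ⟶ C} {k : B ⟶ D}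
    {f' : X ⟶ C} {g' : Y ⟶ D} {H : Path X Y} {J : Path A B} {L : Target C D},
    AVDC.Cell h k J L → CellPath f g H J → f' = f ≫ h → g' = g ≫ k → AVDC.Cell f' g' H L
  /-- `χ ∘ (ψ₁ ∘ φ₁, …, ψₙ ∘ φₙ) = (χ ∘ (ψ₁, …, ψₙ)) ∘ (φ₁ ⌢ ⋯ ⌢ φₙ)`. -/
  vcomp_assoc : ∀ {X Y A B C D E F : K} {p : X ⟶ A} {q : Y ⟶ B} {f : A ⟶ C} {g : B ⟶ D}
    {h : C ⟶ E} {k : D ⟶ F} {G : Path X Y} {H : Path A B} {J : Path C D} {L : Target E F}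
    (χ : AVDC.Cell h k J L) (s : CellGrid p q f g G H J),
    vcomp χ (s.composite vcomp) (Category.assoc p f h).symm (Category.assoc q g k).symm =
      vcomp (vcomp χ s.bottom rfl rfl) s.top rfl rfl
  /-- `id_L ∘ φ = φ`. -/
  tid_vcomp : ∀ {X Y A B : K} {f : X ⟶ A} {g : Y ⟶ B} {H : Path X Y} {L : Target A B}
    (φ : AVDC.Cell f g H L),
    vcomp (tid L) (CellPath.single φ) (Category.comp_id f).symm (Category.comp_id g).symm = φ
  /-- `φ ∘ (id_{J₁}, …, id_{Jₙ}) = φ`. -/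
  vcomp_ids : ∀ {A B C D : K} {f : A ⟶ C} {g : B ⟶ D} {J : Path A B} {L : Target C D}
    (φ : AVDC.Cell f g J L),
    vcomp φ (CellPath.ids J) (Category.id_comp f).symm (Category.id_comp g).symm = φ
  /-- `ψ ∘ (φ₁, …, φᵢ, id_f, φᵢ₊₁, …, φₙ) = ψ ∘ (φ₁, …, φₙ)`. -/
  vcomp_insert : ∀ {X Y Z A B A' C D : K} {f : X ⟶ A} {g : Y ⟶ B} {i : Z ⟶ A'}
    {h : A ⟶ C} {k : A' ⟶ D} {H₁ : Path X Y} {H₂ : Path Y Z} {J₁ : Path A B} {J₂ : Path B A'}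
    {L : Target C D} (ψ : AVDC.Cell h k (J₁.comp J₂) L)
    (φ₁ : CellPath f g H₁ J₁) (φ₂ : CellPath g i H₂ J₂),
    vcomp ψ (φ₁.append (CellPath.cons (AVDC.vid g) φ₂ rfl rfl)) rfl rfl =
      vcomp ψ (φ₁.append φ₂) rfl rfl
  /-- `id_h ∘ id_f = id_{h ∘ f}`. -/
  vid_vcomp_vid : ∀ {A B C : K} (f : A ⟶ B) (h : B ⟶ C),
    vcomp (AVDC.vid h) (CellPath.single (AVDC.vid f)) rfl rfl = AVDC.vid (f ≫ h)

namespace AVDC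

section Universal

variable {K : Type u} [AugVirtualDoubleCategory.{u, v, w, x} K]

/-- The vertical composite `ψ ∘ (φ₁, …, φₙ)`. -/
abbrev comp {X Y A B C D : K} {f : X ⟶ A} {g : Y ⟶ B} {h : A ⟶ C} {k : B ⟶ D}
    {f' : X ⟶ C} {g' : Y ⟶ D} {H : Path X Y} {J : Path A B} {L : Target C D}
    (ψ : Cell h k J L) (φ : CellPath f g H J)
    (hf : f' = f ≫ h := by rfl) (hg : g' = g ≫ k := by rfl) : Cell f' g' H L :=
  AugVirtualDoubleCategory.vcomp ψ φ hf hg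

/-- The vertical composite `ψ ∘ φ` of two cells. -/
abbrev comp₁ {X Y A B C D : K} {f : X ⟶ A} {g : Y ⟶ B} {h : A ⟶ C} {k : B ⟶ D}
    {f' : X ⟶ C} {g' : Y ⟶ D} {H : Path X Y} {J : Target A B} {L : Target C D}
    (ψ : Cell h k J.toPath L) (φ : Cell f g H J)
    (hf : f' = f ≫ h := by rfl) (hg : g' = g ≫ k := by rfl) : Cell f' g' H L :=
  comp ψ (CellPath.single φ) hf hg

/-- The horizontal composite `φ ⊙ ψ := id_{L₁ ⌢ L₂} ∘ (φ, ψ)`, where `L = L₁ ⌢ L₂` is of length at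
most one. -/
def hcomp {X Y Z A B C : K} {f : X ⟶ A} {g : Y ⟶ B} {h : Z ⟶ C}
    {H₁ : Path X Y} {H₂ : Path Y Z} {H : Path X Z}
    {L₁ : Target A B} {L₂ : Target B C} {L : Target A C}
    (φ : Cell f g H₁ L₁) (ψ : Cell g h H₂ L₂)
    (eH : H = H₁.comp H₂) (eL : L.toPath = L₁.toPath.comp L₂.toPath) : Cell f h H L :=
  comp (tid L) (CellPath.cons φ (CellPath.single ψ) eH eL)
    (Category.comp_id f).symm (Category.comp_id h).symm

/-! ### Cartesian and cocartesian cells -/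

/-- A cell `ψ`, with horizontal source of length at most one, is *cartesian* if every cell with
the same horizontal target and with vertical source and target factoring through those of `ψ`
factors uniquely through `ψ`. -/
def IsCartesian {A B C D : K} {f : A ⟶ C} {g : B ⟶ D} {J : Target A B} {L : Target C D}
    (ψ : Cell f g J.toPath L) : Prop :=
  ∀ ⦃X Y : K⦄ (h : X ⟶ A) (k : Y ⟶ B) (f' : X ⟶ C) (g' : Y ⟶ D)
    (hf : f' = h ≫ f) (hg : g' = k ≫ g) (H : Path X Y) (χ : Cell f' g' H L),
    ∃! φ : Cell h k H J, comp₁ ψ φ hf hg = χ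

/-- A path of cells is *weakly nullary-cocartesian* if nullary cells factor uniquely through it. -/
def IsWeaklyNullaryCocartesian {X Y A B : K} {f : X ⟶ A} {g : Y ⟶ B} {H : Path X Y} {J : Path A B}
    (φ : CellPath f g H J) : Prop :=
  ∀ ⦃C : K⦄ (h : A ⟶ C) (k : B ⟶ C) (χ : Cell (f ≫ h) (g ≫ k) H (HTarget.empty C)),
    ∃! χ' : Cell h k J (HTarget.empty C), comp χ' φ = χ

/-- A weakly nullary-cocartesian path of cells `φ`, with vertical source `f`, is
*left nullary-cocartesian* if, for every non-empty path `(K₁, …, Kₚ₋₁, Kₚ)` such that the restriction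
`Kₚ(id, f)` exists, the path `(id_{K₁}, …, id_{Kₚ₋₁}, cart) ⌢ φ` is weakly nullary-cocartesian. -/
def IsLeftNullaryCocartesian {X Y A B : K} {f : X ⟶ A} {g : Y ⟶ B} {H : Path X Y} {J : Path A B}
    (φ : CellPath f g H J) : Prop :=
  IsWeaklyNullaryCocartesian φ ∧
    ∀ ⦃Z W : K⦄ (P : Path Z W) (Q : Hor W A) (R : Hor W X)
      (cart : Cell (𝟙 W) f (HPath.single R) (HTarget.single Q)),
      IsCartesian (J := HTarget.single R) cart →
        IsWeaklyNullaryCocartesian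
          ((CellPath.ids P).append ((CellPath.single cart).append φ))

variable (K) in
/-- `K` has restrictions on the right: for all `J : A ⇸ B` and `g : Y ⟶ B` there is a cartesian cell
defining the (unary) restriction `J(id, g) : A ⇸ Y`. -/
def HasRightRestrictions : Prop :=
  ∀ ⦃A B Y : K⦄ (J : Hor A B) (g : Y ⟶ B),
    ∃ (R : Hor A Y) (cart : Cell (𝟙 A) g (HPath.single R) (HTarget.single J)),
      IsCartesian (J := HTarget.single R) cart

/-- The cell `π` exhibits the object `T` as the *tabulation* of the horizontal morphism `J`. -/
structure IsTabulation {A B T : K} {J : Hor A B} {πA : T ⟶ A} {πB : T ⟶ B}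
    (π : Cell πA πB (HPath.nil T) (HTarget.single J)) : Prop where
  /-- Every cell `φ : X ⇒ J` is of the form `π ∘ φ'` for a unique `φ' : X ⟶ T`. -/
  one_dim : ∀ ⦃X : K⦄ (φA : X ⟶ A) (φB : X ⟶ B)
    (φ : Cell φA φB (HPath.nil X) (HTarget.single J)),
    ∃! φ' : X ⟶ T, ∃ (hA : φA = φ' ≫ πA) (hB : φB = φ' ≫ πB),
      comp π (CellPath.single (vid φ')) hA hB = φ
  /-- With `φ = π ∘ φ'` and `ψ = π ∘ ψ'`: cells `ξA` and `ξB` with `ξA ⊙ ψ = φ ⊙ ξB` are of the form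
  `ξA = πA ∘ ξ'` and `ξB = πB ∘ ξ'` for a unique nullary cell `ξ'`. -/
  two_dim : ∀ ⦃X Y : K⦄ (φ' : X ⟶ T) (ψ' : Y ⟶ T) (H : Path X Y)
    (ξA : Cell (φ' ≫ πA) (ψ' ≫ πA) H (HTarget.empty A))
    (ξB : Cell (φ' ≫ πB) (ψ' ≫ πB) H (HTarget.empty B)),
    hcomp (L := HTarget.single J) ξA (comp π (CellPath.single (vid ψ')))
        (HPath.comp_nil H).symm rfl =
      hcomp (L := HTarget.single J) (comp π (CellPath.single (vid φ'))) ξB rfl rfl →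
    ∃! ξ' : Cell φ' ψ' H (HTarget.empty T),
      comp₁ (J := HTarget.empty T) (vid πA) ξ' = ξA ∧
        comp₁ (J := HTarget.empty T) (vid πB) ξ' = ξB

variable (K) in
/-- `K` has left nullary-cocartesian tabulations: every horizontal morphism admits a tabulation
whose defining cell is left nullary-cocartesian. -/
def HasLeftNullaryCocartesianTabulations : Prop :=
  ∀ ⦃A B : K⦄ (J : Hor A B), ∃ (T : K) (πA : T ⟶ A) (πB : T ⟶ B)
    (π : Cell πA πB (HPath.nil T) (HTarget.single J)),
    IsTabulation π ∧ IsLeftNullaryCocartesian (CellPath.single π)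

/-- A companion of `j : A ⟶ B`: a horizontal morphism `j_* : A ⇸ B` together with a cartesian nullary
cell `j_* ⇒ B` defining it as the restriction `B(j, id)`. -/
structure Companion {A B : K} (j : A ⟶ B) where
  /-- The horizontal morphism `j_*`. -/
  hor : Hor A B
  /-- The cartesian cell defining `j_*`. -/
  cart : Cell j (𝟙 B) (HPath.single hor) (HTarget.empty B)
  /-- This cell is cartesian. -/
  isCartesian : IsCartesian (J := HTarget.single hor) cart

namespace Companion

variable {A B : K} {j : A ⟶ B}

theorem exists_cocart (c : Companion j) :
    ∃! κ : Cell (𝟙 A) j (HPath.nil A) (HTarget.single c.hor),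
      comp₁ (J := HTarget.single c.hor) c.cart κ
        (Category.id_comp j).symm (Category.comp_id j).symm = vid j :=
  c.isCartesian (𝟙 A) j j j _ _ (HPath.nil A) (vid j)

/-- The cocartesian cell `A ⇒ j_*` corresponding to `cart`: the unique cell such that
`cart ∘ cocart = id_j`. -/
noncomputable def cocart (c : Companion j) :
    Cell (𝟙 A) j (HPath.nil A) (HTarget.single c.hor) :=
  c.exists_cocart.choose

theorem cart_comp_cocart (c : Companion j) :
    comp₁ (J := HTarget.single c.hor) c.cart c.cocart
      (Category.id_comp j).symm (Category.comp_id j).symm = vid j :=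
  c.exists_cocart.choose_spec.1

end Companion

/-! ### Left Kan cells -/

/-- The nullary cell `η` is *left Kan*: it defines `l` as the left Kan extension of `d` along the
path `J`. -/
def IsLeftKan {A B M : K} {d : A ⟶ M} {l : B ⟶ M} {J : Path A B}
    (η : Cell d l J (HTarget.empty M)) : Prop :=
  ∀ ⦃C : K⦄ (H : Path B C) (k : C ⟶ M) (φ : Cell d k (J.comp H) (HTarget.empty M)),
    ∃! φ' : Cell l k H (HTarget.empty M), hcomp η φ' rfl rfl = φ

/-- The composite of a nullary cell `η`, with horizontal source `(J₁, …, Jₙ₋₁, Jₙ)`, and the path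
`(id_{J₁}, …, id_{Jₙ₋₁}, cart)`, where `cart : R ⇒ Jₙ`. -/
def restrict {A A' B M Y : K} {d : A ⟶ M} {l : B ⟶ M} {P : Path A A'} {J : Hor A' B}
    (η : Cell d l (P.snoc J) (HTarget.empty M)) {f : Y ⟶ B} {R : Hor A' Y}
    (cart : Cell (𝟙 A') f (HPath.single R) (HTarget.single J)) :
    Cell d (f ≫ l) (P.snoc R) (HTarget.empty M) :=
  comp η ((CellPath.ids P).append (CellPath.single cart)) (Category.id_comp d).symm rfl

/-- The nullary cell `η`, with horizontal source a non-empty path `(J₁, …, Jₙ)`, is *pointwise left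
Kan*: it is left Kan, and so is `η ∘ (id, …, id, cart)` for every `f` such that the restriction
`Jₙ(id, f)` exists. -/
def IsPointwiseLeftKan {A A' B M : K} {d : A ⟶ M} {l : B ⟶ M} {P : Path A A'} {J : Hor A' B}
    (η : Cell d l (P.snoc J) (HTarget.empty M)) : Prop :=
  IsLeftKan η ∧
    ∀ ⦃Y : K⦄ (f : Y ⟶ B) (R : Hor A' Y)
      (cart : Cell (𝟙 A') f (HPath.single R) (HTarget.single J)),
      IsCartesian (J := HTarget.single R) cart → IsLeftKan (restrict η cart)

end Universal

/-! ### The vertical 2-category -/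

section Vertical

variable (K : Type u)

/-- The type of objects of the vertical 2-category `V(K)`: it is `K` itself. -/
def Vert : Type u := K

/-- An object of `K`, regarded as an object of `V(K)`. -/
def Vert.of {K : Type u} (A : K) : Vert K := A

/-- An object of `V(K)`, regarded as an object of `K`. -/
def Vert.obj {K : Type u} (A : Vert K) : K := A

variable {K}
variable [AugVirtualDoubleCategory.{u, v, w, x} K]

/-- Vertical cells `f ⇒ g`. -/
abbrev VCell {A B : K} (f g : A ⟶ B) : Type x := Cell f g (HPath.nil A) (HTarget.empty B)

/-- The composite of vertical cells `f ⇒ g ⇒ h`, that is their horizontal composite in `K`. -/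
def VCell.trans {A B : K} {f g h : A ⟶ B} (φ : VCell f g) (ψ : VCell g h) : VCell f h :=
  hcomp φ ψ rfl rfl

/-- The composite `φ ∘ id_f` of a vertical morphism and a vertical cell. -/
def VCell.whiskerLeft {A B C : K} (f : A ⟶ B) {g h : B ⟶ C} (φ : VCell g h) :
    VCell (f ≫ g) (f ≫ h) :=
  comp₁ (J := HTarget.empty B) φ (vid f)

/-- The composite `id_h ∘ φ` of a vertical cell and a vertical morphism. -/
def VCell.whiskerRight {A B C : K} {f g : A ⟶ B} (φ : VCell f g) (h : B ⟶ C) :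
    VCell (f ≫ h) (g ≫ h) :=
  comp₁ (J := HTarget.empty B) (vid h) φ

theorem comp_comp {X Y A B C D E F : K} {p : X ⟶ A} {q : Y ⟶ B} {f : A ⟶ C} {g : B ⟶ D}
    {h : C ⟶ E} {k : D ⟶ F} {G : Path X Y} {H : Path A B} {J : Path C D} {L : Target E F}
    (χ : Cell h k J L) (s : CellGrid p q f g G H J) {u : X ⟶ E} {v : Y ⟶ F}
    (hu : u = (p ≫ f) ≫ h) (hv : v = (q ≫ g) ≫ k) {u' : A ⟶ E} {v' : B ⟶ F}
    (hu' : u' = f ≫ h) (hv' : v' = g ≫ k) (hu'' : u = p ≫ u') (hv'' : v = q ≫ v') :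
    comp χ (s.composite AugVirtualDoubleCategory.vcomp) hu hv =
      comp (comp χ s.bottom hu' hv') s.top hu'' hv'' := by
  subst hu' hv' hu'' hv''
  exact AugVirtualDoubleCategory.vcomp_assoc χ s

theorem comp_vid_cons {X Z A A' C D : K} {f : X ⟶ A} {i : Z ⟶ A'}
    {h : A ⟶ C} {k : A' ⟶ D} {H : Path X Z} {J : Path A A'} {L : Target C D} (ψ : Cell h k J L)
    (φ : CellPath f i H J) {u : X ⟶ C} {v : Z ⟶ D} (hu : u = f ≫ h) (hv : v = i ≫ k) :
    comp ψ (CellPath.cons (vid f) φ rfl rfl) hu hv = comp ψ φ hu hv := by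
  subst hu hv
  exact AugVirtualDoubleCategory.vcomp_insert (J₁ := HPath.nil A) ψ (CellPath.nil f) φ

theorem comp_cons_vid {X A C D : K} {f g : X ⟶ A} {h : A ⟶ C} {k : A ⟶ D} {L : Target C D}
    (ψ : Cell h k (HPath.nil A) L) (φ : VCell f g)
    {u : X ⟶ C} {v : X ⟶ D} (hu : u = f ≫ h) (hv : v = g ≫ k) :
    comp ψ (CellPath.cons φ (CellPath.single (vid g)) rfl rfl) hu hv =
      comp₁ (J := HTarget.empty A) ψ φ hu hv := by
  subst hu hv
  exact AugVirtualDoubleCategory.vcomp_insert (J₁ := HPath.nil A) (J₂ := HPath.nil A) ψ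
    (CellPath.single φ) (CellPath.nil g)

theorem vid_comp₁_vid {A B C : K} (f : A ⟶ B) (h : B ⟶ C) {u : A ⟶ C} (hu : u = f ≫ h) :
    comp₁ (J := HTarget.empty B) (vid h) (vid f) hu hu = vid u := by
  subst hu
  exact AugVirtualDoubleCategory.vid_vcomp_vid f h

theorem vid_id_comp₁ {A B : K} {f g : A ⟶ B} (φ : VCell f g) :
    comp₁ (J := HTarget.empty B) (vid (𝟙 B)) φ
      (Category.comp_id f).symm (Category.comp_id g).symm = φ :=
  AugVirtualDoubleCategory.tid_vcomp φ

theorem comp₁_vid_id {A B : K} {f g : A ⟶ B} (φ : VCell f g) :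
    comp₁ (J := HTarget.empty A) φ (vid (𝟙 A))
      (Category.id_comp f).symm (Category.id_comp g).symm = φ :=
  (comp_vid_cons φ (CellPath.nil (𝟙 A)) _ _).trans (AugVirtualDoubleCategory.vcomp_ids φ)

theorem comp₁_comp {X A C E : K} {p q : X ⟶ A} {f g : A ⟶ C} {h k : C ⟶ E}
    (χ : VCell h k) (ψ : VCell f g) (φ : CellPath p q (HPath.nil X) (HPath.nil A))
    {a b : X ⟶ E} {a' b' : A ⟶ E} {a'' b'' : X ⟶ C}
    (h₁ : a = a'' ≫ h) (h₂ : b = b'' ≫ k) (h₃ : a'' = p ≫ f) (h₄ : b'' = q ≫ g)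
    (h₅ : a = p ≫ a') (h₆ : b = q ≫ b') (h₇ : a' = f ≫ h) (h₈ : b' = g ≫ k)
    (hφ : φ.append (CellPath.nil q) = φ) :
    comp₁ (J := HTarget.empty C) χ (comp ψ φ h₃ h₄) h₁ h₂ =
      comp (comp₁ (J := HTarget.empty C) χ ψ h₇ h₈) φ h₅ h₆ := by
  subst h₃ h₄
  exact (comp_comp χ (CellGrid.cons (L₁ := HTarget.empty C) ψ φ (CellGrid.nil q g))
    h₁ h₂ h₇ h₈ h₅ h₆).trans (congrArg (fun t : CellPath p q (HPath.nil X) (HPath.nil A) =>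
      comp (comp₁ (J := HTarget.empty C) χ ψ h₇ h₈) t h₅ h₆) hφ)

theorem comp₁_comp₁ {X A C E : K} {p q : X ⟶ A} {f g : A ⟶ C} {h k : C ⟶ E}
    (χ : VCell h k) (ψ : VCell f g) (φ : VCell p q) {a b : X ⟶ E} {a' b' : A ⟶ E} {a'' b'' : X ⟶ C}
    (h₁ : a = a'' ≫ h) (h₂ : b = b'' ≫ k) (h₃ : a'' = p ≫ f) (h₄ : b'' = q ≫ g)
    (h₅ : a = p ≫ a') (h₆ : b = q ≫ b') (h₇ : a' = f ≫ h) (h₈ : b' = g ≫ k) :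
    comp₁ (J := HTarget.empty C) χ (comp₁ (J := HTarget.empty A) ψ φ h₃ h₄) h₁ h₂ =
      comp₁ (J := HTarget.empty A) (comp₁ (J := HTarget.empty C) χ ψ h₇ h₈) φ h₅ h₆ :=
  comp₁_comp χ ψ (CellPath.single (L := HTarget.empty A) φ) h₁ h₂ h₃ h₄ h₅ h₆ h₇ h₈ rfl

theorem trans_comp_comp {X A C : K} {p q r : X ⟶ A} {f g h : A ⟶ C}
    (ψ₁ : VCell f g) (φ₁ : CellPath p q (HPath.nil X) (HPath.nil A))
    (ψ₂ : VCell g h) (φ₂ : CellPath q r (HPath.nil X) (HPath.nil A))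
    {a b c : X ⟶ C} (ha : a = p ≫ f) (hb : b = q ≫ g) (hc : c = r ≫ h)
    (hφ : φ₂.append (CellPath.nil r) = φ₂) :
    VCell.trans (comp ψ₁ φ₁ ha hb) (comp ψ₂ φ₂ hb hc) =
      comp (VCell.trans ψ₁ ψ₂) (φ₁.append φ₂) ha hc := by
  subst ha hb hc
  have e := comp_comp (vid (𝟙 C)) (CellGrid.cons (L₁ := HTarget.empty C) ψ₁ φ₁
    (CellGrid.cons (L₁ := HTarget.empty C) ψ₂ φ₂ (CellGrid.nil r h))) (u := p ≫ f) (v := r ≫ h)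
    (Category.comp_id _).symm (Category.comp_id _).symm (u' := f) (v' := h)
    (Category.comp_id _).symm (Category.comp_id _).symm rfl rfl
  exact e.trans (congrArg (fun t : CellPath q r (HPath.nil X) (HPath.nil A) =>
    comp (VCell.trans ψ₁ ψ₂) (φ₁.append t)) hφ)

theorem vid_trans {A B : K} {f g : A ⟶ B} (φ : VCell f g) : VCell.trans (vid f) φ = φ :=
  (comp_vid_cons (vid (𝟙 B)) (CellPath.single (L := HTarget.empty B) φ) _ _).trans
    (vid_id_comp₁ φ)

theorem trans_vid {A B : K} {f g : A ⟶ B} (φ : VCell f g) : VCell.trans φ (vid g) = φ :=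
  (comp_cons_vid (vid (𝟙 B)) φ _ _).trans (vid_id_comp₁ φ)

theorem trans_trans {A B : K} {f g h k : A ⟶ B} (φ : VCell f g) (ψ : VCell g h) (χ : VCell h k) :
    VCell.trans (VCell.trans φ ψ) χ = VCell.trans φ (VCell.trans ψ χ) := by
  have e₁ := trans_comp_comp (vid (𝟙 B)) (CellPath.cons (L₁ := HTarget.empty B) φ
    (CellPath.single (L := HTarget.empty B) ψ) rfl rfl) (vid (𝟙 B))
    (CellPath.single (L := HTarget.empty B) χ) (Category.comp_id f).symm (Category.comp_id h).symm
    (Category.comp_id k).symm rfl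
  have e₂ := trans_comp_comp (vid (𝟙 B)) (CellPath.single (L := HTarget.empty B) φ)
    (vid (𝟙 B)) (CellPath.cons (L₁ := HTarget.empty B) ψ
    (CellPath.single (L := HTarget.empty B) χ) rfl rfl) (Category.comp_id f).symm
    (Category.comp_id g).symm (Category.comp_id k).symm rfl
  exact (congrArg (VCell.trans (VCell.trans φ ψ)) (vid_id_comp₁ χ).symm).trans
    (e₁.trans (e₂.symm.trans (congrArg (fun t : VCell f g => VCell.trans t (VCell.trans ψ χ))
      (vid_id_comp₁ φ))))

theorem trans_whiskerLeft {A B C : K} (f : A ⟶ B) {g h k : B ⟶ C} (φ : VCell g h)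
    (ψ : VCell h k) :
    VCell.whiskerLeft f (VCell.trans φ ψ) =
      VCell.trans (VCell.whiskerLeft f φ) (VCell.whiskerLeft f ψ) :=
  ((trans_comp_comp φ (CellPath.single (L := HTarget.empty B) (vid f)) ψ
    (CellPath.single (L := HTarget.empty B) (vid f)) rfl rfl rfl rfl).trans
      (comp_vid_cons _ (CellPath.single (L := HTarget.empty B) (vid f)) _ _)).symm

theorem trans_whiskerRight {A B C : K} {f g h : A ⟶ B} (φ : VCell f g) (ψ : VCell g h)
    (k : B ⟶ C) :
    VCell.whiskerRight (VCell.trans φ ψ) k =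
      VCell.trans (VCell.whiskerRight φ k) (VCell.whiskerRight ψ k) := by
  have e₁ := trans_comp_comp (vid k) (CellPath.single (L := HTarget.empty B) φ) (vid k)
    (CellPath.single (L := HTarget.empty B) ψ) rfl rfl rfl rfl
  have e₂ := comp₁_comp (vid k) (vid (𝟙 B)) (CellPath.cons (L₁ := HTarget.empty B) φ
    (CellPath.single (L := HTarget.empty B) ψ) rfl rfl) (a := f ≫ k) (b := h ≫ k) rfl rfl
    (Category.comp_id f).symm (Category.comp_id h).symm rfl rfl (Category.id_comp k).symm
    (Category.id_comp k).symm rfl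
  rw [vid_trans] at e₁
  rw [vid_comp₁_vid] at e₂
  exact e₂.trans e₁.symm

theorem whisker_exchange {A B C : K} {f g : A ⟶ B} {h k : B ⟶ C} (φ : VCell f g)
    (ψ : VCell h k) :
    VCell.trans (VCell.whiskerLeft f ψ) (VCell.whiskerRight φ k) =
      VCell.trans (VCell.whiskerRight φ h) (VCell.whiskerLeft g ψ) := by
  have e₁ := trans_comp_comp ψ (CellPath.single (L := HTarget.empty B) (vid f)) (vid k)
    (CellPath.single (L := HTarget.empty B) φ) rfl rfl rfl rfl
  have e₂ := trans_comp_comp (vid h) (CellPath.single (L := HTarget.empty B) φ) ψ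
    (CellPath.single (L := HTarget.empty B) (vid g)) rfl rfl rfl rfl
  rw [trans_vid] at e₁
  rw [vid_trans] at e₂
  exact (e₁.trans (comp_vid_cons ψ (CellPath.single (L := HTarget.empty B) φ) _ _)).trans
    (e₂.trans (comp_cons_vid ψ φ _ _)).symm

theorem comp₁_vid_comp {A B C D : K} (f : A ⟶ B) (g : B ⟶ C) {h h' : C ⟶ D} (φ : VCell h h')
    (e : (f ≫ g) ≫ h = f ≫ g ≫ h) (e' : (f ≫ g) ≫ h' = f ≫ g ≫ h') :
    VCell.whiskerLeft (f ≫ g) φ =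
      comp₁ (J := HTarget.empty B) (VCell.whiskerLeft g φ) (vid f) e e' := by
  have e₁ := comp₁_comp₁ φ (vid g) (vid f) rfl rfl rfl rfl e e' rfl rfl
  rw [vid_comp₁_vid] at e₁
  exact e₁

theorem vid_comp_comp₁ {A B C D : K} {f f' : A ⟶ B} (φ : VCell f f') (g : B ⟶ C) (h : C ⟶ D)
    (e : f ≫ g ≫ h = (f ≫ g) ≫ h) (e' : f' ≫ g ≫ h = (f' ≫ g) ≫ h) :
    VCell.whiskerRight φ (g ≫ h) =
      comp₁ (J := HTarget.empty C) (vid h) (VCell.whiskerRight φ g) e e' := by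
  have e₁ := comp₁_comp₁ (vid h) (vid g) φ e e' rfl rfl rfl rfl rfl rfl
  exact (e₁.trans (congrArg (fun t : VCell (g ≫ h) (g ≫ h) => comp₁ (J := HTarget.empty B) t φ)
    (vid_comp₁_vid g h rfl))).symm

instance : CategoryStruct.{v} (Vert K) where
  Hom A B := A.obj ⟶ B.obj
  id A := 𝟙 A.obj
  comp f g := CategoryStruct.comp (obj := K) f g

/-- A vertical morphism of `K`, regarded as a morphism of `V(K)`. -/
def Vert.hom {A B : K} (f : A ⟶ B) : Vert.of A ⟶ Vert.of B := f

instance (A B : Vert K) : Category.{x} (A ⟶ B) where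
  Hom f g := VCell (K := K) f g
  id f := vid (K := K) f
  comp φ ψ := VCell.trans φ ψ
  id_comp := vid_trans
  comp_id := trans_vid
  assoc := trans_trans

theorem Vert.id_comp {A B : Vert K} (f : A ⟶ B) : 𝟙 A ≫ f = f := Category.id_comp (obj := K) f

theorem Vert.comp_id {A B : Vert K} (f : A ⟶ B) : f ≫ 𝟙 B = f := Category.comp_id (obj := K) f

theorem Vert.assoc {A B C D : Vert K} (f : A ⟶ B) (g : B ⟶ C) (h : C ⟶ D) :
    (f ≫ g) ≫ h = f ≫ g ≫ h := Category.assoc (obj := K) f g h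

theorem eqToHom_comp₁ {X Y : Vert K} {A : K} {p q : X.obj ⟶ A} {f g : A ⟶ Y.obj}
    (ψ : VCell f g) (φ : VCell p q) {a b a' b' : X ⟶ Y}
    (ha : a = p ≫ f) (hb : b = q ≫ g) (ea : a' = a) (eb : b = b') :
    eqToHom ea ≫ (comp₁ (J := HTarget.empty A) ψ φ ha hb : a ⟶ b) ≫ eqToHom eb =
      (comp₁ (J := HTarget.empty A) ψ φ (ea.trans ha) (eb.symm.trans hb) : a' ⟶ b') := by
  subst ea eb
  simp

theorem Vert.id_whiskerLeft {A B : Vert K} {f g : A ⟶ B} (φ : f ⟶ g) :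
    (VCell.whiskerLeft (K := K) (𝟙 A.obj) φ : 𝟙 A ≫ f ⟶ 𝟙 A ≫ g) =
      eqToHom (Vert.id_comp f) ≫ φ ≫
        eqToHom (Vert.id_comp g).symm := by
  have e := eqToHom_comp₁ (X := A) (Y := B) φ (vid (𝟙 A.obj))
    (Vert.id_comp f).symm (Vert.id_comp g).symm
    (Vert.id_comp f) (Vert.id_comp g).symm
  exact e.symm.trans (congrArg (fun t : f ⟶ g => eqToHom (Vert.id_comp f) ≫ t ≫
    eqToHom (Vert.id_comp g).symm) (comp₁_vid_id (K := K) φ))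

theorem Vert.whiskerRight_id {A B : Vert K} {f g : A ⟶ B} (φ : f ⟶ g) :
    (VCell.whiskerRight (K := K) φ (𝟙 B.obj) : f ≫ 𝟙 B ⟶ g ≫ 𝟙 B) =
      eqToHom (Vert.comp_id f) ≫ φ ≫
        eqToHom (Vert.comp_id g).symm := by
  have e := eqToHom_comp₁ (X := A) (Y := B) (vid (𝟙 B.obj)) φ
    (Vert.comp_id f).symm (Vert.comp_id g).symm
    (Vert.comp_id f) (Vert.comp_id g).symm
  exact e.symm.trans (congrArg (fun t : f ⟶ g => eqToHom (Vert.comp_id f) ≫ t ≫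
    eqToHom (Vert.comp_id g).symm) (vid_id_comp₁ (K := K) φ))

theorem Vert.comp_whiskerLeft {A B C D : Vert K} (f : A ⟶ B) (g : B ⟶ C) {h h' : C ⟶ D}
    (φ : h ⟶ h') :
    (VCell.whiskerLeft (K := K) (f ≫ g) φ : (f ≫ g) ≫ h ⟶ (f ≫ g) ≫ h') =
      eqToHom (Vert.assoc f g h) ≫
        (VCell.whiskerLeft (K := K) f (VCell.whiskerLeft (K := K) g φ) :
          f ≫ g ≫ h ⟶ f ≫ g ≫ h') ≫ eqToHom (Vert.assoc f g h').symm := by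
  have e := eqToHom_comp₁ (X := A) (Y := D) (VCell.whiskerLeft (K := K) g φ) (vid (K := K) f) rfl rfl
    (Vert.assoc f g h) (Vert.assoc f g h').symm
  exact (comp₁_vid_comp (K := K) f g φ (Vert.assoc f g h) (Vert.assoc f g h')).trans e.symm

theorem Vert.whiskerRight_comp {A B C D : Vert K} {f f' : A ⟶ B} (φ : f ⟶ f') (g : B ⟶ C)
    (h : C ⟶ D) :
    (VCell.whiskerRight (K := K) φ (g ≫ h) : f ≫ g ≫ h ⟶ f' ≫ g ≫ h) =
      eqToHom (Vert.assoc f g h).symm ≫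
        (VCell.whiskerRight (K := K) (VCell.whiskerRight (K := K) φ g) h :
          (f ≫ g) ≫ h ⟶ (f' ≫ g) ≫ h) ≫ eqToHom (Vert.assoc f' g h) := by
  have e := eqToHom_comp₁ (X := A) (Y := D) (vid (K := K) h) (VCell.whiskerRight (K := K) φ g) rfl rfl
    (Vert.assoc f g h).symm (Vert.assoc f' g h)
  exact (vid_comp_comp₁ (K := K) φ g h (Vert.assoc f g h).symm (Vert.assoc f' g h).symm).trans
    e.symm

theorem Vert.whisker_assoc {A B C D : Vert K} (f : A ⟶ B) {g g' : B ⟶ C} (φ : g ⟶ g')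
    (h : C ⟶ D) :
    (VCell.whiskerRight (K := K) (VCell.whiskerLeft (K := K) f φ) h :
        (f ≫ g) ≫ h ⟶ (f ≫ g') ≫ h) =
      eqToHom (Vert.assoc f g h) ≫
        (VCell.whiskerLeft (K := K) f (VCell.whiskerRight (K := K) φ h) :
          f ≫ g ≫ h ⟶ f ≫ g' ≫ h) ≫ eqToHom (Vert.assoc f g' h).symm := by
  have e := eqToHom_comp₁ (X := A) (Y := D) (VCell.whiskerRight (K := K) φ h) (vid (K := K) f) rfl rfl
    (Vert.assoc f g h) (Vert.assoc f g' h).symm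
  exact (comp₁_comp₁ (K := K) (vid (K := K) h) φ (vid (K := K) f) rfl rfl rfl rfl
    (Vert.assoc f g h) (Vert.assoc f g' h) rfl rfl).trans e.symm

theorem Vert.whiskerLeft_eqToHom {A B C : Vert K} (f : A ⟶ B) {g h : B ⟶ C} (e : g = h) :
    (VCell.whiskerLeft (K := K) f (eqToHom e) : f ≫ g ⟶ f ≫ h) =
      eqToHom (congrArg (fun t => f ≫ t) e) := by
  subst e
  exact vid_comp₁_vid (K := K) f g rfl

theorem Vert.whiskerRight_eqToHom {A B C : Vert K} {f g : A ⟶ B} (e : f = g) (h : B ⟶ C) :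
    (VCell.whiskerRight (K := K) (eqToHom e) h : f ≫ h ⟶ g ≫ h) =
      eqToHom (congrArg (fun t => t ≫ h) e) := by
  subst e
  exact vid_comp₁_vid (K := K) f h rfl

theorem Vert.pentagon {A B C D E : Vert K} (f : A ⟶ B) (g : B ⟶ C) (h : C ⟶ D) (i : D ⟶ E) :
    (VCell.whiskerRight (K := K) (eqToHom (Vert.assoc f g h)) i :
        ((f ≫ g) ≫ h) ≫ i ⟶ (f ≫ g ≫ h) ≫ i) ≫
      eqToHom (Vert.assoc f (g ≫ h) i) ≫
      (VCell.whiskerLeft (K := K) f (eqToHom (Vert.assoc g h i)) :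
        f ≫ (g ≫ h) ≫ i ⟶ f ≫ g ≫ h ≫ i) =
      eqToHom (Vert.assoc (f ≫ g) h i) ≫ eqToHom (Vert.assoc f g (h ≫ i)) := by
  refine (congrArg₂ (fun (s : ((f ≫ g) ≫ h) ≫ i ⟶ (f ≫ g ≫ h) ≫ i)
    (t : f ≫ (g ≫ h) ≫ i ⟶ f ≫ g ≫ h ≫ i) => s ≫ eqToHom (Vert.assoc f (g ≫ h) i) ≫ t)
    (Vert.whiskerRight_eqToHom (Vert.assoc f g h) i)
    (Vert.whiskerLeft_eqToHom f (Vert.assoc g h i))).trans ?_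
  simp only [eqToHom_trans]

theorem Vert.triangle {A B C : Vert K} (f : A ⟶ B) (g : B ⟶ C) :
    eqToHom (Vert.assoc f (𝟙 B) g) ≫
      (VCell.whiskerLeft (K := K) f (eqToHom (Vert.id_comp g)) : f ≫ 𝟙 B ≫ g ⟶ f ≫ g) =
      VCell.whiskerRight (K := K) (eqToHom (Vert.comp_id f)) g := by
  refine (congrArg (fun (t : f ≫ 𝟙 B ≫ g ⟶ f ≫ g) => eqToHom (Vert.assoc f (𝟙 B) g) ≫ t)
    (Vert.whiskerLeft_eqToHom f (Vert.id_comp g))).trans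
      ((eqToHom_trans _ _).trans (Vert.whiskerRight_eqToHom (Vert.comp_id f) g).symm)

/-- The vertical 2-category `V(K)`: its objects are those of `K`, its morphisms are the vertical
morphisms of `K`, and its cells are the vertical cells of `K`. -/
instance : Bicategory.{x, v} (Vert K) where
  whiskerLeft f _ _ φ := VCell.whiskerLeft (K := K) f φ
  whiskerRight φ h := VCell.whiskerRight (K := K) φ h
  associator f g h := eqToIso (Vert.assoc f g h)
  leftUnitor f := eqToIso (Vert.id_comp f)
  rightUnitor f := eqToIso (Vert.comp_id f)
  whiskerLeft_id f g := vid_comp₁_vid (K := K) f g rfl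
  whiskerLeft_comp f _ _ _ φ ψ := trans_whiskerLeft (K := K) f φ ψ
  id_whiskerLeft φ := Vert.id_whiskerLeft φ
  comp_whiskerLeft f g _ _ φ := Vert.comp_whiskerLeft f g φ
  id_whiskerRight f g := vid_comp₁_vid (K := K) f g rfl
  comp_whiskerRight φ ψ k := trans_whiskerRight (K := K) φ ψ k
  whiskerRight_id φ := Vert.whiskerRight_id φ
  whiskerRight_comp φ g h := Vert.whiskerRight_comp φ g h
  whisker_assoc f _ _ φ h := Vert.whisker_assoc f φ h
  whisker_exchange φ ψ := whisker_exchange (K := K) φ ψ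
  pentagon f g h i := Vert.pentagon f g h i
  triangle f g := Vert.triangle f g

instance : Bicategory.Strict (Vert K) where
  id_comp f := Vert.id_comp f
  comp_id f := Vert.comp_id f
  assoc f g h := Vert.assoc f g h
  leftUnitor_eqToIso _ := by rfl
  rightUnitor_eqToIso _ := by rfl
  associator_eqToIso _ _ _ := by rfl

/-- A vertical cell of `K`, regarded as a cell of `V(K)`. -/
def Vert.cell {A B : K} {f g : A ⟶ B} (φ : VCell f g) : Vert.hom f ⟶ Vert.hom g := φ


end Vertical

end AVDC

/-! # Pointwise left Kan extensions in a 2-category -/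

namespace TwoCat

open Bicategory

variable {B : Type u} [Bicategory.{w, v} B] [Bicategory.Strict B]

/-- In a 2-category, the cell `κ : f ∘ p ⇒ g ∘ q` exhibits `t` as the comma object `f / g`. -/
structure IsComma {a b c t : B} (f : a ⟶ c) (g : b ⟶ c) (p : t ⟶ a) (q : t ⟶ b)
    (κ : p ≫ f ⟶ q ≫ g) : Prop where
  /-- Every cell `κ' : f ∘ p' ⇒ g ∘ q'` is of the form `κ ∘ u`, for a unique morphism `u` (necessarily
  with `p ∘ u = p'` and `q ∘ u = q'`). -/
  one_dim : ∀ ⦃x : B⦄ (p' : x ⟶ a) (q' : x ⟶ b) (κ' : p' ≫ f ⟶ q' ≫ g),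
    ∃! u : x ⟶ t, ∃ (hp : u ≫ p = p') (hq : u ≫ q = q'),
      (α_ u p f).hom ≫ u ◁ κ ≫ (α_ u q g).inv ≫ eqToHom (congrArg (fun r => r ≫ g) hq) =
        eqToHom (congrArg (fun r => r ≫ f) hp) ≫ κ'
  /-- Any cells `ξ : p ∘ y ⇒ p ∘ z` and `ζ : q ∘ y ⇒ q ∘ z`, compatible with `κ ∘ y` and `κ ∘ z`, are of
  the form `ξ = p ∘ ω` and `ζ = q ∘ ω` for a unique cell `ω : y ⇒ z`. -/
  two_dim : ∀ ⦃x : B⦄ (y z : x ⟶ t) (ξ : y ≫ p ⟶ z ≫ p) (ζ : y ≫ q ⟶ z ≫ q),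
    ξ ▷ f ≫ (α_ z p f).hom ≫ z ◁ κ ≫ (α_ z q g).inv =
      (α_ y p f).hom ≫ y ◁ κ ≫ (α_ y q g).inv ≫ ζ ▷ g →
    ∃! ω : y ⟶ z, ω ▷ p = ξ ∧ ω ▷ q = ζ

/-- In a 2-category, the cell `η : d ⇒ l ∘ j` exhibits `l` as the pointwise left Kan extension of `d`
along `j`, in the sense of Street: for every morphism `f : c ⟶ b`, the pasting of `η` with the cell
`κ : j ∘ p ⇒ f ∘ q` of a comma object `j / f` exhibits `l ∘ f` as the left Kan extension of `d ∘ p`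
along `q`. -/
def IsPointwiseLeftKan {a b m : B} (j : a ⟶ b) (d : a ⟶ m) (l : b ⟶ m) (η : d ⟶ j ≫ l) : Prop :=
  ∀ ⦃c : B⦄ (f : c ⟶ b) ⦃t : B⦄ (p : t ⟶ a) (q : t ⟶ c) (κ : p ≫ j ⟶ q ≫ f),
    IsComma j f p q κ →
      Nonempty (LeftExtension.IsKan (f := q) (g := p ≫ d)
        (LeftExtension.mk (f ≫ l) (p ◁ η ≫ (α_ p j l).inv ≫ κ ▷ l ≫ (α_ q f l).hom)))

end TwoCat

/-! Fix `f : C ⟶ B` and let `R` be the restriction `j_*(id, f)`. Composing the cartesian cell of `R`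
with that of the companion shows that `R` is also the restriction `B(j, f)`, so a cell into `R` with
empty source is the same as a vertical cell from a composite with `j` to a composite with `f`. Hence
a tabulation of `R` is a comma object `j / f` in `V(K)` (`IsTabulation.isComma`).

From `cocart ⊙ cart = id` it follows that `η' = (η' ∘ cocart) ⊙ (l ∘ cart)`. So pasting `η` with the
comma cell gives the restriction of `η'` along `f`, composed with the tabulating cell `π`
(`Companion.pasting_eq`). As nullary cells factor uniquely through `π`, Street's condition at this
comma object says precisely that the restriction of `η'` is left Kan as far as the empty path `H` is
concerned (`isLeftKanAt_nil_iff`). Any other comma object `j / f` is isomorphic to the tabulation,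
compatibly with the projections and the comma cells, so its cell into `R` has the same factorisation
property.

It remains to pass from the empty path to all paths `H`, for all `f` at once
(`isLeftKan_of_isLeftKanAt_nil`). Tabulate the last morphism `L` of `H` by `T`, and restrict the
morphism `Q` before `L` along the projection of `T` to the source of `L`. Because the tabulation is
left nullary-cocartesian, nullary cells out of `(…, Q, L)` correspond to nullary cells out of the
shorter path that ends in the restricted `Q`. When `L` is the only morphism of `H`, the role of `Q`
is played by `R`; its restriction is a restriction of `j_*` along a longer composite, which is why
the hypothesis must range over all `f`. -/

namespace HPath

/-! ### Paths and induction on their last two morphisms. -/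

variable {K : Type u} {Hor : K → K → Type w}

/-- The number of horizontal morphisms in a path. -/
def length : ∀ {A B : K}, HPath Hor A B → ℕ
  | _, _, nil _ => 0
  | _, _, cons _ p => length p + 1

theorem length_comp {A B C : K} (p : HPath Hor A B) (q : HPath Hor B C) :
    (p.comp q).length = p.length + q.length := by
  induction p with
  | nil => simp [length]
  | cons J p ih => simp [length, ih]; omega

theorem eq_comp_cons_single {A B C D : K} (J : Hor A B) (J' : Hor B C) (p : HPath Hor C D) :
    ∃ (X Y : K) (q : HPath Hor A X) (Q : Hor X Y) (L : Hor Y D),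
      cons J (cons J' p) = q.comp (cons Q (single L)) := by
  induction p generalizing A B with
  | nil => exact ⟨_, _, nil _, J, J', rfl⟩
  | cons J'' p ih =>
    obtain ⟨X, Y, q, Q, L, e⟩ := ih J' J''
    exact ⟨X, Y, cons J q, Q, L, by rw [e]; rfl⟩

/-- Induction on paths, in which the last two morphisms of a path are replaced by a single one. -/
theorem induction_last {A : K} {motive : ∀ {B : K}, HPath Hor A B → Prop}
    (nil : motive (nil A)) (single : ∀ {B : K} (J : Hor A B), motive (single J))
    (step : ∀ {X Y B : K} (q : HPath Hor A X) (Q : Hor X Y) (L : Hor Y B),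
      (∀ {Z : K} (Q' : Hor X Z), motive (q.comp (HPath.single Q'))) →
        motive (q.comp (cons Q (HPath.single L))))
    {B : K} (p : HPath Hor A B) : motive p := by
  -- Induction on the length is needed: the shortened path is not a subpath, and it may end at a
  -- different object.
  obtain ⟨n, hn⟩ : ∃ n, p.length = n := ⟨_, rfl⟩
  induction n generalizing B with
  | zero =>
    cases p with
    | nil => exact nil
    | cons J p => simp [length] at hn
  | succ n ih =>
    cases p with
    | nil => exact nil
    | cons J p =>
      cases p with
      | nil => exact single J
      | cons J' p =>
        obtain ⟨X, Y, q, Q, L, e⟩ := eq_comp_cons_single J J' p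
        rw [e] at hn ⊢
        refine step q Q L fun Q' => ih _ ?_
        simp only [length_comp, length] at hn ⊢
        omega

end HPath

/-! ### Calculus of vertical and horizontal composites. -/

namespace AVDC

variable {K : Type u}

section Struct

variable [AugVirtualDoubleStruct.{u, v, w, x} K]

/-- The empty path is a right unit for concatenation only up to propositional equality, so the two
sides have different types and are compared heterogeneously. -/
theorem CellPath.append_nil {X Y A B : K} {f : X ⟶ A} {g : Y ⟶ B} {H : Path X Y} {J : Path A B}
    (φ : CellPath f g H J) : φ.append (CellPath.nil g) ≍ φ := by
  induction φ with
  | nil f => rfl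
  | @cons _ _ _ _ _ _ _ _ _ H₁ L₁ H₂ J₂ _ _ φ r eH eJ ih =>
    subst eH eJ
    have e₁ : H₂.comp (HPath.nil _) = H₂ := HPath.comp_nil _
    have e₂ : J₂.comp (HPath.nil _) = J₂ := HPath.comp_nil _
    simp only [CellPath.append]
    generalize_proofs p₁ p₂
    revert ih p₁ p₂
    generalize CellPath.append r (CellPath.nil _) = s
    rw [HPath.comp_assoc, HPath.comp_assoc]
    revert s
    rw [e₁, e₂]
    intro s hs _ _
    rw [eq_of_heq hs]

end Struct

variable [AugVirtualDoubleCategory.{u, v, w, x} K]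

theorem comp_heq {X Y A B C D : K} {f : X ⟶ A} {g : Y ⟶ B} {h : A ⟶ C} {k : B ⟶ D}
    {f' : X ⟶ C} {g' : Y ⟶ D} {H H' : Path X Y} {J J' : Path A B} {L : Target C D}
    {ψ : Cell h k J L} {ψ' : Cell h k J' L} {φ : CellPath f g H J} {φ' : CellPath f g H' J'}
    (eH : H = H') (eJ : J = J') (hψ : ψ ≍ ψ') (hφ : φ ≍ φ') (hf : f' = f ≫ h) (hg : g' = g ≫ k) :
    comp ψ φ hf hg ≍ comp ψ' φ' hf hg := by
  subst eH eJ hψ hφ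
  rfl

/-- `ψ ∘ (id_{J₁}, …, id_{Jₙ}) = ψ`. -/
theorem comp_ids {A B C D : K} {f : A ⟶ C} {g : B ⟶ D} {J : Path A B} {L : Target C D}
    (φ : Cell f g J L) :
    comp φ (CellPath.ids J) (Category.id_comp f).symm (Category.id_comp g).symm = φ :=
  AugVirtualDoubleCategory.vcomp_ids φ

/-- `id_L ∘ φ = φ`. -/
theorem tid_comp₁ {X Y A B : K} {f : X ⟶ A} {g : Y ⟶ B} {H : Path X Y} {L : Target A B}
    (φ : Cell f g H L) :
    comp₁ (tid L) φ (Category.comp_id f).symm (Category.comp_id g).symm = φ :=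
  AugVirtualDoubleCategory.tid_vcomp φ

/-- `ψ ∘ id_L = ψ`. -/
theorem comp₁_tid {A B C D : K} {f : A ⟶ C} {g : B ⟶ D} {J : Target A B} {L : Target C D}
    (φ : Cell f g J.toPath L) :
    comp₁ φ (tid J) (Category.id_comp f).symm (Category.id_comp g).symm = φ := by
  cases J with
  | empty => exact (comp_vid_cons φ (CellPath.nil (𝟙 A)) _ _).trans (comp_ids φ)
  | single J => exact comp_ids φ

/-- `χ ∘ (ψ ∘ φ) = (χ ∘ ψ) ∘ φ`, where `φ` is a path of cells. -/
theorem comp₁_comp_path {X Y A B C D E F : K} {p : X ⟶ A} {q : Y ⟶ B} {f : A ⟶ C} {g : B ⟶ D}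
    {h : C ⟶ E} {k : D ⟶ F} {G : Path X Y} {H : Path A B} {J : Target C D} {L : Target E F}
    (χ : Cell h k J.toPath L) (ψ : Cell f g H J) (φ : CellPath p q G H)
    {a : X ⟶ E} {b : Y ⟶ F} {a' : A ⟶ E} {b' : B ⟶ F} {a'' : X ⟶ C} {b'' : Y ⟶ D}
    (h₁ : a = a'' ≫ h) (h₂ : b = b'' ≫ k) (h₃ : a'' = p ≫ f) (h₄ : b'' = q ≫ g)
    (h₅ : a = p ≫ a') (h₆ : b = q ≫ b') (h₇ : a' = f ≫ h) (h₈ : b' = g ≫ k) :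
    comp₁ χ (comp ψ φ h₃ h₄) h₁ h₂ = comp (comp₁ χ ψ h₇ h₈) φ h₅ h₆ := by
  subst h₃ h₄
  have eJ : J.toPath.comp (HPath.nil D) = J.toPath := HPath.comp_nil _
  -- A grid with one column has boundaries ending in a superfluous empty path. The associativity
  -- axiom is applied to a copy of `χ` whose source is padded in this way, and the padding is then
  -- removed on both sides.
  obtain ⟨χ', hχ⟩ : ∃ χ' : Cell h k (J.toPath.comp (HPath.nil D)) L, χ' ≍ χ :=
    ⟨cast (by rw [eJ]) χ, cast_heq _ _⟩
  have e := comp_comp χ' (CellGrid.cons ψ φ (CellGrid.nil q g)) h₁ h₂ h₇ h₈ h₅ h₆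
  have e₁ : comp χ' ((CellGrid.cons ψ φ (CellGrid.nil q g)).composite
      AugVirtualDoubleCategory.vcomp) h₁ h₂ ≍ comp₁ χ (comp ψ φ rfl rfl) h₁ h₂ := by
    refine comp_heq (HPath.comp_nil G) eJ hχ ?_ h₁ h₂
    simp only [CellGrid.composite, CellPath.single]
    congr 1 <;> simp
  have e₂ : comp (comp χ' (CellGrid.cons ψ φ (CellGrid.nil q g)).bottom h₇ h₈)
      (CellGrid.cons ψ φ (CellGrid.nil q g)).top h₅ h₆ ≍ comp (comp₁ χ ψ h₇ h₈) φ h₅ h₆ := by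
    refine comp_heq (HPath.comp_nil G) (HPath.comp_nil H) ?_ (CellPath.append_nil φ) h₅ h₆
    refine comp_heq (HPath.comp_nil H) eJ hχ ?_ h₇ h₈
    simp only [CellGrid.bottom, CellPath.single]
    congr 1 <;> simp
  exact eq_of_heq (e₁.symm.trans ((heq_of_eq e).trans e₂))

/-- `χ ∘ (ψ₁ ∘ φ₁, ψ₂ ∘ φ₂) = (χ ∘ (ψ₁, ψ₂)) ∘ (φ₁ ⌢ φ₂)`. -/
theorem comp_cons_comp_comp {X Y Z A B B' C D D' E F : K} {p : X ⟶ A} {q : Y ⟶ B} {r : Z ⟶ B'}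
    {f : A ⟶ C} {g : B ⟶ D} {g' : B' ⟶ D'} {h : C ⟶ E} {k : D' ⟶ F}
    {G₁ : Path X Y} {H₁ : Path A B} {L₁ : Target C D} {G₂ : Path Y Z} {H₂ : Path B B'}
    {L₂ : Target D D'} {J : Path C D'} {L : Target E F} (χ : Cell h k J L)
    (ψ₁ : Cell f g H₁ L₁) (φ₁ : CellPath p q G₁ H₁) (ψ₂ : Cell g g' H₂ L₂) (φ₂ : CellPath q r G₂ H₂)
    (eJ : J = L₁.toPath.comp L₂.toPath) {a : X ⟶ E} {b : Z ⟶ F} {a' : A ⟶ E} {b' : B' ⟶ F}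
    {s : X ⟶ C} {t : Y ⟶ D} {s' : Z ⟶ D'} (hs : s = p ≫ f) (ht : t = q ≫ g) (hs' : s' = r ≫ g')
    (h₁ : a = s ≫ h) (h₂ : b = s' ≫ k) (h₃ : a' = f ≫ h) (h₄ : b' = g' ≫ k)
    (h₅ : a = p ≫ a') (h₆ : b = r ≫ b') :
    comp χ (CellPath.cons (comp ψ₁ φ₁ hs ht) (CellPath.single (comp ψ₂ φ₂ ht hs')) rfl eJ) h₁ h₂ =
      comp (comp χ (CellPath.cons ψ₁ (CellPath.single ψ₂) rfl eJ) h₃ h₄) (φ₁.append φ₂) h₅ h₆ := by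
  subst hs ht hs'
  have eJ' : L₁.toPath.comp (L₂.toPath.comp (HPath.nil D')) = J := by
    rw [HPath.comp_nil, eJ]
  obtain ⟨χ', hχ⟩ : ∃ χ' : Cell h k (L₁.toPath.comp (L₂.toPath.comp (HPath.nil D'))) L, χ' ≍ χ :=
    ⟨cast (by rw [eJ']) χ, cast_heq _ _⟩
  have e := comp_comp χ' (CellGrid.cons ψ₁ φ₁ (CellGrid.cons ψ₂ φ₂ (CellGrid.nil r g')))
    h₁ h₂ h₃ h₄ h₅ h₆
  have eG : G₁.comp (G₂.comp (HPath.nil Z)) = G₁.comp G₂ := by rw [HPath.comp_nil]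
  have eH : H₁.comp (H₂.comp (HPath.nil B')) = H₁.comp H₂ := by rw [HPath.comp_nil]
  have e₁ : comp χ' ((CellGrid.cons ψ₁ φ₁ (CellGrid.cons ψ₂ φ₂ (CellGrid.nil r g'))).composite
      AugVirtualDoubleCategory.vcomp) h₁ h₂ ≍ comp χ (CellPath.cons (comp ψ₁ φ₁ rfl rfl)
        (CellPath.single (comp ψ₂ φ₂ rfl rfl)) rfl eJ) h₁ h₂ := by
    refine comp_heq eG eJ' hχ ?_ h₁ h₂
    simp only [CellGrid.composite, CellPath.single]
    congr 1 <;> first | simp [eJ] | (congr 1 <;> simp)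
  have e₂ : comp (comp χ' (CellGrid.cons ψ₁ φ₁ (CellGrid.cons ψ₂ φ₂ (CellGrid.nil r g'))).bottom
      h₃ h₄) (CellGrid.cons ψ₁ φ₁ (CellGrid.cons ψ₂ φ₂ (CellGrid.nil r g'))).top h₅ h₆ ≍
      comp (comp χ (CellPath.cons ψ₁ (CellPath.single ψ₂) rfl eJ) h₃ h₄)
        (φ₁.append φ₂) h₅ h₆ := by
    refine comp_heq eG eH ?_ ?_ h₅ h₆
    · refine comp_heq eH eJ' hχ ?_ h₃ h₄
      simp only [CellGrid.bottom, CellPath.single]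
      congr 1 <;> first | simp [eJ] | (congr 1 <;> simp)
    · simp only [CellGrid.top]
      congr 1 <;> first | exact CellPath.append_nil _ | simp
  exact eq_of_heq (e₁.symm.trans ((heq_of_eq e).trans e₂))

/-- `ψ ∘ (φ, id_g) = ψ ∘ φ`. -/
theorem comp_cons_single_vid {X Y A B C D : K} {f : X ⟶ A} {g : Y ⟶ B} {h : A ⟶ C} {k : B ⟶ D}
    {H H' : Path X Y} {J : Path A B} {L' : Target A B} {L : Target C D} (ψ : Cell h k J L)
    (φ : Cell f g H' L') (eH : H = H'.comp (HPath.nil Y)) (eJ : J = L'.toPath.comp (HPath.nil B))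
    {u : X ⟶ C} {v : Y ⟶ D} (hu : u = f ≫ h) (hv : v = g ≫ k) :
    comp ψ (CellPath.cons φ (CellPath.single (vid g)) eH eJ) hu hv =
      comp ψ (CellPath.cons φ (CellPath.nil g) eH eJ) hu hv := by
  subst hu hv eH eJ
  exact AugVirtualDoubleCategory.vcomp_insert (J₁ := L'.toPath) (J₂ := HPath.nil B) ψ
    (CellPath.single φ) (CellPath.nil g)

/-- Interchange of vertical and horizontal composition. -/
theorem hcomp_comp_comp {X Y Z A B B' C D D' : K} {p : X ⟶ A} {q : Y ⟶ B} {r : Z ⟶ B'}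
    {f : A ⟶ C} {g : B ⟶ D} {g' : B' ⟶ D'}
    {G₁ : Path X Y} {H₁ : Path A B} {L₁ : Target C D} {G₂ : Path Y Z} {H₂ : Path B B'}
    {L₂ : Target D D'} {L : Target C D'}
    (ψ₁ : Cell f g H₁ L₁) (φ₁ : CellPath p q G₁ H₁) (ψ₂ : Cell g g' H₂ L₂) (φ₂ : CellPath q r G₂ H₂)
    (eL : L.toPath = L₁.toPath.comp L₂.toPath)
    {s : X ⟶ C} {t : Y ⟶ D} {s' : Z ⟶ D'} (hs : s = p ≫ f) (ht : t = q ≫ g) (hs' : s' = r ≫ g') :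
    hcomp (comp ψ₁ φ₁ hs ht) (comp ψ₂ φ₂ ht hs') rfl eL =
      comp (hcomp ψ₁ ψ₂ rfl eL) (φ₁.append φ₂) hs hs' :=
  comp_cons_comp_comp _ _ _ _ _ _ _ _ _ _ _ _ _ _ _

/-- `χ ∘ (φ ⊙ ψ) = χ ∘ (φ, ψ)`. -/
theorem comp₁_hcomp {X Y Z A B C D E : K} {f : X ⟶ A} {g : Y ⟶ B} {h : Z ⟶ C}
    {H₁ : Path X Y} {H₂ : Path Y Z} {H : Path X Z} {L₁ : Target A B} {L₂ : Target B C}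
    {L : Target A C} {L' : Target D E} {m : A ⟶ D} {n : C ⟶ E} (χ : Cell m n L.toPath L')
    (φ : Cell f g H₁ L₁) (ψ : Cell g h H₂ L₂)
    (eH : H = H₁.comp H₂) (eL : L.toPath = L₁.toPath.comp L₂.toPath)
    {a : X ⟶ D} {b : Z ⟶ E} (ha : a = f ≫ m) (hb : b = h ≫ n) :
    comp₁ χ (hcomp φ ψ eH eL) ha hb =
      comp χ (CellPath.cons φ (CellPath.single ψ) eH eL) ha hb := by
  have e := comp₁_comp_path χ (tid L) (CellPath.cons φ (CellPath.single ψ) eH eL) ha hb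
    (Category.comp_id f).symm (Category.comp_id h).symm ha hb (Category.id_comp m).symm
    (Category.id_comp n).symm
  rw [comp₁_tid] at e
  exact e

theorem hcomp_vid {X Y A C : K} {f : X ⟶ A} {g : Y ⟶ C} {H : Path X Y} {L : Target A C}
    (χ : Cell f g H L) :
    hcomp χ (vid g) (HPath.comp_nil H).symm (HPath.comp_nil L.toPath).symm = χ :=
  (comp_cons_single_vid _ _ _ _ _ _).trans (tid_comp₁ χ)

theorem vid_hcomp {X Y A C : K} {f : X ⟶ A} {g : Y ⟶ C} {H : Path X Y} {L : Target A C}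
    (χ : Cell f g H L) : hcomp (vid f) χ rfl rfl = χ :=
  (comp_vid_cons _ _ _ _).trans (tid_comp₁ χ)

/-- `(χ ∘ φ) ⊙ (id_k ∘ ψ) = χ ∘ (φ, ψ)`. -/
theorem hcomp_comp₁_vid_comp₁ {X Y Z A B C D : K} {f : X ⟶ A} {g : Y ⟶ B} {g' : Z ⟶ B}
    {h : A ⟶ C} {k : B ⟶ D} {J : Hor A B} {L : Target C D} {H₁ : Path X Y} {H₂ : Path Y Z}
    (χ : Cell h k (HPath.single J) L) (φ : Cell f g H₁ (HTarget.single J))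
    (ψ : Cell g g' H₂ (HTarget.empty B)) {s : X ⟶ C} {t : Y ⟶ D} {s' : Z ⟶ D}
    (hs : s = f ≫ h) (ht : t = g ≫ k) (hs' : s' = g' ≫ k) :
    hcomp (comp₁ (J := HTarget.single J) χ φ hs ht)
        (comp₁ (J := HTarget.empty B) (vid k) ψ ht hs') rfl (HPath.comp_nil L.toPath).symm =
      comp χ (CellPath.cons φ (CellPath.single ψ) rfl rfl) hs hs' := by
  have e := hcomp_comp_comp χ (CellPath.single (L := HTarget.single J) φ) (vid k)
    (CellPath.single (L := HTarget.empty B) ψ) (HPath.comp_nil L.toPath).symm hs ht hs'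
  exact e.trans (congrArg (fun t => comp t (CellPath.cons φ (CellPath.single ψ) rfl rfl) hs hs')
    (hcomp_vid χ))

/-- `(id_h ∘ φ) ⊙ (χ ∘ ψ) = χ ∘ (φ, ψ)`. -/
theorem hcomp_vid_comp₁_comp₁ {X Y Z A B C D : K} {f : X ⟶ A} {g : Y ⟶ A} {g' : Z ⟶ B}
    {h : A ⟶ C} {k : B ⟶ D} {J : Target A B} {L : Target C D} {H₁ : Path X Y} {H₂ : Path Y Z}
    (χ : Cell h k J.toPath L) (φ : Cell f g H₁ (HTarget.empty A)) (ψ : Cell g g' H₂ J)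
    {s : X ⟶ C} {t : Y ⟶ C} {s' : Z ⟶ D}
    (hs : s = f ≫ h) (ht : t = g ≫ h) (hs' : s' = g' ≫ k) :
    hcomp (comp₁ (J := HTarget.empty A) (vid h) φ hs ht) (comp₁ χ ψ ht hs') rfl rfl =
      comp χ (CellPath.cons φ (CellPath.single ψ) rfl rfl) hs hs' := by
  have e := hcomp_comp_comp (vid h) (CellPath.single (L := HTarget.empty A) φ) χ
    (CellPath.single ψ) rfl hs ht hs'
  exact e.trans (congrArg (fun t => comp t (CellPath.cons φ (CellPath.single ψ) rfl rfl) hs hs')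
    (vid_hcomp χ))

/-! ### Cartesian cells and the companion identities. -/

/-- Cartesian cells compose. -/
theorem IsCartesian.comp₁ {A B C D E F : K} {f : A ⟶ C} {g : B ⟶ D} {f₁ : C ⟶ E} {g₁ : D ⟶ F}
    {J : Target A B} {L : Target C D} {N : Target E F} {χ : Cell f₁ g₁ L.toPath N}
    {ψ : Cell f g J.toPath L} (hχ : IsCartesian χ) (hψ : IsCartesian ψ) {a : A ⟶ E} {b : B ⟶ F}
    (ha : a = f ≫ f₁) (hb : b = g ≫ g₁) : IsCartesian (J := J) (AVDC.comp₁ χ ψ ha hb) := by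
  intro X Y h k f' g' hf hg H ω
  have hf' : f' = (h ≫ f) ≫ f₁ := by rw [hf, ha, Category.assoc]
  have hg' : g' = (k ≫ g) ≫ g₁ := by rw [hg, hb, Category.assoc]
  obtain ⟨α, hα, uα⟩ := hχ (h ≫ f) (k ≫ g) f' g' hf' hg' H ω
  obtain ⟨β, hβ, uβ⟩ := hψ h k (h ≫ f) (k ≫ g) rfl rfl H α
  have key (γ : Cell h k H J) : AVDC.comp₁ χ (AVDC.comp₁ ψ γ) hf' hg' =
      AVDC.comp₁ (AVDC.comp₁ χ ψ ha hb) γ hf hg := comp₁_comp_path _ _ _ _ _ _ _ _ _ _ _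
  refine ⟨β, ?_, fun γ hγ => uβ γ (uα _ ((key γ).trans hγ))⟩
  exact (key β).symm.trans ((congrArg (fun t => AVDC.comp₁ χ t hf' hg') hβ).trans hα)

theorem isCartesian_hid {A B : K} (J : Hor A B) : IsCartesian (J := HTarget.single J) (hid J) := by
  intro X Y h k f' g' hf hg H χ
  rw [Category.comp_id] at hf hg
  subst hf hg
  exact ⟨χ, tid_comp₁ χ, fun φ hφ => (tid_comp₁ φ).symm.trans hφ⟩

/-- `cocart ⊙ cart = id_{j_*}`. -/
theorem Companion.cocart_hcomp_cart {A B : K} {j : A ⟶ B} (c : Companion j) :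
    hcomp (L := HTarget.single c.hor) c.cocart c.cart rfl rfl = hid c.hor := by
  -- By interchange the left side is `(cart ∘ cocart) ⊙ cart`, which is `id_j ⊙ cart`.
  have e₁ : comp c.cart (CellPath.cons c.cocart (CellPath.single c.cart) rfl rfl)
      (Category.id_comp j).symm (Category.comp_id _).symm = c.cart := by
    refine (hcomp_comp₁_vid_comp₁ c.cart c.cocart c.cart (Category.id_comp j).symm
      (Category.comp_id j).symm (Category.comp_id _).symm).symm.trans ?_
    rw [c.cart_comp_cocart]
    refine Eq.trans ?_ (vid_hcomp c.cart)
    exact congrArg (fun t => hcomp (vid j) t rfl rfl) (tid_comp₁ c.cart)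
  -- Both `cocart ⊙ cart` and the identity of `j_*` become `cart` after composition with `cart`, so
  -- they agree by uniqueness of factorisations.
  obtain ⟨_, _, u⟩ := c.isCartesian (𝟙 A) (𝟙 B) j (𝟙 B) (Category.id_comp j).symm
    (Category.comp_id _).symm (HPath.single c.hor) c.cart
  refine (u _ ?_).trans (u _ ?_).symm
  · exact (comp₁_hcomp (L := HTarget.single c.hor) c.cart c.cocart c.cart rfl rfl _ _).trans e₁
  · exact comp₁_tid (J := HTarget.single c.hor) c.cart

/-- The nullary cell `η'` is recovered from the vertical cell `η' ∘ cocart`: for `ρ : H ⇒ j_*` we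
have `(η' ∘ cocart) ∘ p ⊙ l ∘ (cart ∘ ρ) = η' ∘ ρ`. -/
theorem Companion.hcomp_whisker {A B M X Y : K} {j : A ⟶ B} {d : A ⟶ M} {l : B ⟶ M}
    (c : Companion j) (η : Cell d l (HPath.single c.hor) (HTarget.empty M)) {p : X ⟶ A} {g : Y ⟶ B}
    {H : Path X Y} (ρ : Cell p g H (HTarget.single c.hor)) {a : X ⟶ M} {b : X ⟶ M} {e : Y ⟶ M}
    {p' : X ⟶ B} {g' : Y ⟶ B} (ha : a = p ≫ d) (hb : b = p ≫ j ≫ l) (hb' : b = p' ≫ l)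
    (he' : e = g' ≫ l) (he : e = g ≫ l) (hp : p' = p ≫ j) (hg : g' = g ≫ 𝟙 B) :
    hcomp (comp₁ (J := HTarget.empty A)
        (comp₁ (J := HTarget.single c.hor) η c.cocart (Category.id_comp d).symm rfl)
          (vid p) ha hb)
      (comp₁ (J := HTarget.empty B) (vid l)
        (comp₁ (J := HTarget.single c.hor) c.cart ρ hp hg) hb' he') rfl rfl =
      comp₁ (J := HTarget.single c.hor) η ρ ha he := by
  have e₁ := comp₁_hcomp (L := HTarget.single c.hor) η c.cocart c.cart rfl rfl
    (Category.id_comp d).symm (Category.id_comp l).symm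
  have e₂ := hcomp_comp₁_vid_comp₁ η c.cocart c.cart (Category.id_comp d).symm
    rfl (Category.id_comp l).symm
  have e₃ := comp₁_tid (J := HTarget.single c.hor) η
  rw [c.cocart_hcomp_cart] at e₁
  -- This is `(η ∘ cocart) ⊙ (l ∘ cart) = η`; the general claim follows by composing it with `ρ`.
  have e₄ := e₂.trans (e₁.symm.trans e₃)
  have e₅ := comp₁_comp_path (J := HTarget.empty B) (vid l) c.cart
    (CellPath.single (L := HTarget.single c.hor) ρ) hb' he' hp hg hb he rfl
    (Category.id_comp l).symm
  have e₆ := hcomp_comp_comp (comp₁ (J := HTarget.single c.hor) η c.cocart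
    (Category.id_comp d).symm rfl) (CellPath.single (L := HTarget.empty A) (vid p))
    (comp₁ (J := HTarget.empty B) (vid l) c.cart rfl (Category.id_comp l).symm)
    (CellPath.single (L := HTarget.single c.hor) ρ) (L := HTarget.empty M) rfl ha hb he
  rw [e₄] at e₆
  exact (congrArg (hcomp _ · rfl rfl) e₅).trans (e₆.trans (comp_vid_cons η _ _ _))

/-! ### Left Kan cells: reduction to the empty path. -/

/-- The universal property of left Kan cells with respect to a single path `H`. -/
def IsLeftKanAt {A B M C : K} {d : A ⟶ M} {l : B ⟶ M} {J : Path A B}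
    (η : Cell d l J (HTarget.empty M)) (H : Path B C) : Prop :=
  ∀ (k : C ⟶ M) (φ : Cell d k (J.comp H) (HTarget.empty M)),
    ∃! φ' : Cell l k H (HTarget.empty M), hcomp η φ' rfl rfl = φ

/-- Interchange gives `(η ∘ s) ⊙ (γ ∘ t) = (η ⊙ γ) ∘ (s ⌢ t)`. Since composing with `t` and with `s
⌢ t` are bijections on nullary cells, factoring `φ` through `η` amounts to factoring `φ ∘ (s ⌢ t)`
through `η ∘ s`. This allows `H` to be replaced by the simpler path `H'`. -/
theorem IsLeftKanAt.of_append {A A' B B' M C C' : K} {d : A ⟶ M} {l : B ⟶ M} {J : Path A B}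
    {J' : Path A' B'} {H : Path B C} {H' : Path B' C'} {η : Cell d l J (HTarget.empty M)}
    {e : A' ⟶ A} {a : B' ⟶ B} {b : C' ⟶ C} {s : CellPath e a J' J} {t : CellPath a b H' H}
    (ht : IsWeaklyNullaryCocartesian t) (hst : IsWeaklyNullaryCocartesian (s.append t))
    {d' : A' ⟶ M} {l' : B' ⟶ M} (hd : d' = e ≫ d) (hl : l' = a ≫ l)
    (hK : IsLeftKanAt (comp η s hd hl) H') : IsLeftKanAt η H := by
  subst hd hl
  intro k φ
  obtain ⟨ω, hω, uω⟩ := hK (b ≫ k) (comp φ (s.append t))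
  obtain ⟨φ', hφ', uφ'⟩ := ht l k ω
  have key (γ : Cell l k H (HTarget.empty M)) :
      hcomp (comp η s) (comp γ t) rfl rfl = comp (hcomp η γ rfl rfl) (s.append t) :=
    hcomp_comp_comp _ _ _ _ _ _ _ _
  refine ⟨φ', ?_, fun γ hγ => uφ' γ (uω _ ?_)⟩
  · refine (hst d k (comp φ (s.append t))).unique ?_ rfl
    rw [← key, hφ', hω]
  · exact (key γ).trans (congrArg (comp · (s.append t)) hγ)

/-- By interchange `(η ∘ π) ⊙ (γ ∘ q) = (η ⊙ γ) ∘ π`, and composition with `π` is a bijection on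
nullary cells. The right-hand condition is the one that makes sense in `V(K)`: it says that `η ∘ π`
is a left Kan extension along `q`. -/
theorem isLeftKanAt_nil_iff {A B M T : K} {d : A ⟶ M} {l : B ⟶ M} {R : Hor A B} {p : T ⟶ A}
    {q : T ⟶ B} {π : Cell p q (HPath.nil T) (HTarget.single R)}
    (hπ : IsWeaklyNullaryCocartesian (CellPath.single π))
    (η : Cell d l (HPath.single R) (HTarget.empty M)) :
    IsLeftKanAt η (HPath.nil B) ↔ ∀ (k : B ⟶ M) (φ : VCell (p ≫ d) (q ≫ k)),
      ∃! φ' : VCell l k,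
        VCell.trans (comp₁ (J := HTarget.single R) η π) (VCell.whiskerLeft q φ') = φ := by
  have key (k : B ⟶ M) (γ : VCell l k) :
      VCell.trans (comp₁ (J := HTarget.single R) η π) (VCell.whiskerLeft q γ) =
        comp₁ (J := HTarget.single R) (hcomp η γ rfl rfl) π :=
    (hcomp_comp_comp η (CellPath.single (L := HTarget.single R) π) γ
      (CellPath.single (L := HTarget.empty B) (vid q)) (L := HTarget.empty M) rfl rfl rfl rfl).trans
      (comp_cons_single_vid _ _ _ _ _ _)
  refine ⟨fun h k φ => ?_, fun h k φ => ?_⟩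
  · obtain ⟨φ₁, hφ₁, uφ₁⟩ := hπ d k φ
    obtain ⟨φ', hφ', uφ'⟩ := h k φ₁
    refine ⟨φ', (key k φ').trans ((congrArg (comp₁ (J := HTarget.single R) · π) hφ').trans hφ₁),
      fun γ hγ => uφ' γ (uφ₁ _ ((key k γ).symm.trans hγ))⟩
  · obtain ⟨φ', hφ', uφ'⟩ := h k (comp₁ (J := HTarget.single R) φ π)
    refine ⟨φ', (hπ d k (comp₁ (J := HTarget.single R) φ π)).unique ((key k φ').symm.trans hφ') rfl,
      fun γ hγ => uφ' γ ((key k γ).trans (congrArg (comp₁ (J := HTarget.single R) · π) hγ))⟩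

theorem IsLeftKanAt.of_heq {A B M C : K} {d : A ⟶ M} {l l' : B ⟶ M} {J : Path A B}
    {η : Cell d l J (HTarget.empty M)} {η' : Cell d l' J (HTarget.empty M)} {H : Path B C}
    (h : IsLeftKanAt η H) (hl : l' = l) (hη : η ≍ η') : IsLeftKanAt η' H := by
  subst hl hη
  exact h

/-- If the restrictions of `η` have the universal property of left Kan cells with respect to empty
paths, then they have it with respect to all paths. -/
theorem isLeftKan_of_isLeftKanAt_nil (hR : HasRightRestrictions K)
    (hT : HasLeftNullaryCocartesianTabulations K) {A B M : K} {d : A ⟶ M} {l : B ⟶ M} {J : Hor A B}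
    (η : Cell d l (HPath.single J) (HTarget.empty M))
    (h : ∀ ⦃Y : K⦄ (f : Y ⟶ B) (R : Hor A Y)
      (cart : Cell (𝟙 A) f (HPath.single R) (HTarget.single J)),
      IsCartesian (J := HTarget.single R) cart →
        IsLeftKanAt (restrict (P := HPath.nil A) η cart) (HPath.nil Y))
    {Y : K} (f : Y ⟶ B) (R : Hor A Y) (cart : Cell (𝟙 A) f (HPath.single R) (HTarget.single J))
    (hc : IsCartesian (J := HTarget.single R) cart) :
    IsLeftKan (restrict (P := HPath.nil A) η cart) := by
  intro C H
  change IsLeftKanAt (comp₁ (J := HTarget.single J) η cart (Category.id_comp d).symm rfl) H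
  induction H using HPath.induction_last with
  | nil => exact h f R cart hc
  | single L =>
    obtain ⟨T, πA, πB, π, -, hπ, hπ'⟩ := hT L
    obtain ⟨R', cart', hc'⟩ := hR R πA
    have hcc := hc.comp₁ (J := HTarget.single R') (L := HTarget.single R) hc'
      (Category.id_comp (𝟙 A)).symm rfl
    have e := comp₁_comp_path (J := HTarget.single J) η cart
      (CellPath.single (L := HTarget.single R) cart') (Category.id_comp d).symm rfl
      (Category.id_comp (𝟙 A)).symm rfl (Category.id_comp d).symm (Category.assoc _ _ _)
      (Category.id_comp d).symm rfl
    -- Here the path `(L)` is traded for the empty path at `T`, at the cost of restricting `R` along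
    -- `πA`. The composite of the two cartesian cells defines a restriction of `J` along `πA ≫ f`,
    -- where the hypothesis applies.
    refine IsLeftKanAt.of_append (s := CellPath.single (L := HTarget.single R) cart') hπ
      (hπ' (HPath.nil A) R R' cart' hc') (Category.id_comp d).symm (Category.assoc πA f l) ?_
    have := h (πA ≫ f) R' _ hcc
    exact e ▸ this
  | step q Q L ih =>
    obtain ⟨T, πA, πB, π, -, hπ, hπ'⟩ := hT L
    obtain ⟨Q', cart', hc'⟩ := hR Q πA
    -- The morphism before `L` now lies in `H`, so `R` itself is kept and `s` is an identity. Left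
    -- nullary-cocartesianness of `π` is used twice: with the prefix `q` for the factor, and with
    -- the prefix `(R) ⌢ q` for the whole path.
    refine IsLeftKanAt.of_append (s := CellPath.ids (HPath.single R)) (hπ' q Q Q' cart' hc')
      (hπ' (HPath.cons R q) Q Q' cart' hc') (Category.id_comp d).symm
      (Category.id_comp (f ≫ l)).symm ?_
    have e := comp_ids (comp₁ (J := HTarget.single J) η cart (Category.id_comp d).symm
      (rfl : f ≫ l = f ≫ l))
    exact (congrArg (IsLeftKanAt · (q.comp (HPath.single Q'))) e).mpr (ih Q')

/-- To be pointwise left Kan can be tested on empty paths. -/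
theorem isPointwiseLeftKan_iff (hR : HasRightRestrictions K)
    (hT : HasLeftNullaryCocartesianTabulations K) {A B M : K} {d : A ⟶ M} {l : B ⟶ M} {J : Hor A B}
    (η : Cell d l (HPath.single J) (HTarget.empty M)) :
    IsPointwiseLeftKan (P := HPath.nil A) η ↔ ∀ ⦃Y : K⦄ (f : Y ⟶ B) (R : Hor A Y)
      (cart : Cell (𝟙 A) f (HPath.single R) (HTarget.single J)),
      IsCartesian (J := HTarget.single R) cart →
        IsLeftKanAt (restrict (P := HPath.nil A) η cart) (HPath.nil Y) := by
  refine ⟨fun h Y f R cart hc => h.2 f R cart hc (HPath.nil Y), fun h => ?_⟩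
  have h' := fun Y f R cart hc => isLeftKan_of_isLeftKanAt_nil hR hT η h (Y := Y) f R cart hc
  refine ⟨fun C H => ?_, h'⟩
  -- The cell `η` is its own restriction along the identity. The equality is heterogeneous because
  -- the vertical target `𝟙 B ≫ l` equals `l` only propositionally.
  have e : restrict (P := HPath.nil A) η (hid J) ≍ η := by
    have e₁ := comp₁_tid (J := HTarget.single J) η
    refine HEq.trans ?_ (heq_of_eq e₁)
    have (l' : B ⟶ M) (hl : l' = 𝟙 B ≫ l) : comp₁ (J := HTarget.single J) η (hid J)
        (Category.id_comp d).symm rfl ≍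
        comp₁ (J := HTarget.single J) η (hid J) (Category.id_comp d).symm hl := by
      subst hl
      rfl
    exact this l (Category.id_comp l).symm
  exact IsLeftKanAt.of_heq (H := H) (h' B (𝟙 B) J (hid J) (isCartesian_hid J) H)
    (Category.id_comp l).symm e

/-! ### Comma objects in the vertical 2-category and tabulations. -/

/-- `(ψ ∘ v) ∘ u = ψ ∘ (v ∘ u)`. -/
theorem comp₁_vid_comp₁_vid {X Y Z A B : K} {p : Z ⟶ A} {q : Z ⟶ B} {J : Target A B}
    (ψ : Cell p q (HPath.nil Z) J) (u : X ⟶ Y) (v : Y ⟶ Z) {a : X ⟶ A} {b : X ⟶ B} {a' : Y ⟶ A}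
    {b' : Y ⟶ B} {t : X ⟶ Z} (ht : t = u ≫ v) (ha : a = u ≫ a') (hb : b = u ≫ b')
    (ha' : a' = v ≫ p) (hb' : b' = v ≫ q) (hap : a = t ≫ p) (hbq : b = t ≫ q) :
    comp₁ (J := HTarget.empty Y) (comp₁ (J := HTarget.empty Z) ψ (vid v) ha' hb') (vid u) ha hb =
      comp₁ (J := HTarget.empty Z) ψ (vid t) hap hbq := by
  have e := comp₁_comp_path (J := HTarget.empty Z) ψ (vid v)
    (CellPath.single (L := HTarget.empty Y) (vid u)) hap hbq ht ht ha hb ha' hb'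
  exact e.symm.trans (congrArg (comp₁ (J := HTarget.empty Z) ψ · hap hbq) (vid_comp₁_vid u v ht))

open TwoCat Bicategory in
/-- The one-dimensional universal property of comma objects in `V(K)`. -/
theorem isComma_one_dim_iff {A B C T X : K} {j : A ⟶ B} {f : C ⟶ B} {p : T ⟶ A} {q : T ⟶ C}
    (κ : VCell (p ≫ j) (q ≫ f)) {p' : X ⟶ A} {q' : X ⟶ C} (κ' : VCell (p' ≫ j) (q' ≫ f))
    (t : X ⟶ T) :
    (∃ (hp : Vert.hom t ≫ Vert.hom p = Vert.hom p') (hq : Vert.hom t ≫ Vert.hom q = Vert.hom q'),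
      (α_ (Vert.hom t) (Vert.hom p) (Vert.hom j)).hom ≫ Vert.hom t ◁ (Vert.cell (K := K) κ) ≫
        (α_ (Vert.hom t) (Vert.hom q) (Vert.hom f)).inv ≫
          eqToHom (congrArg (fun r => r ≫ Vert.hom f) hq) =
        eqToHom (congrArg (fun r => r ≫ Vert.hom j) hp) ≫ Vert.cell (K := K) κ') ↔
    ∃ (hp : p' = t ≫ p) (hq : q' = t ≫ q),
      comp₁ (J := HTarget.empty T) κ (vid t) (by rw [hp, Category.assoc])
        (by rw [hq, Category.assoc]) = κ' := by
  have key (hp : p' = t ≫ p) (hq : q' = t ≫ q) :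
      ((α_ (Vert.hom t) (Vert.hom p) (Vert.hom j)).hom ≫ Vert.hom t ◁ (Vert.cell (K := K) κ) ≫
        (α_ (Vert.hom t) (Vert.hom q) (Vert.hom f)).inv ≫
          eqToHom (congrArg (fun r : Vert.of X ⟶ Vert.of C => r ≫ Vert.hom f) hq.symm) =
        eqToHom (congrArg (fun r : Vert.of X ⟶ Vert.of A => r ≫ Vert.hom j) hp.symm) ≫ Vert.cell (K := K) κ') ↔
      comp₁ (J := HTarget.empty T) κ (vid t) (by rw [hp, Category.assoc])
        (by rw [hq, Category.assoc]) = κ' := by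
    subst hp hq
    -- The associators are equality cells; conjugating by them only changes the stated vertical
    -- source and target of the composite `κ ∘ t`.
    have e := eqToHom_comp₁ (X := Vert.of X) (Y := Vert.of B) κ (vid t) rfl rfl
      (Vert.assoc (Vert.hom t) (Vert.hom p) (Vert.hom j))
      (Vert.assoc (Vert.hom t) (Vert.hom q) (Vert.hom f)).symm
    have e' : (α_ (Vert.hom t) (Vert.hom p) (Vert.hom j)).hom ≫ Vert.hom t ◁ (Vert.cell (K := K) κ) ≫
        (α_ (Vert.hom t) (Vert.hom q) (Vert.hom f)).inv = _ := e
    exact Eq.congr ((congrArg (fun s => (α_ (Vert.hom t) (Vert.hom p) (Vert.hom j)).hom ≫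
      Vert.hom t ◁ (Vert.cell (K := K) κ) ≫ s) (Category.comp_id _)).trans e') (Category.id_comp _)
  exact ⟨fun ⟨hp, hq, e⟩ => ⟨hp.symm, hq.symm, (key hp.symm hq.symm).1 e⟩,
    fun ⟨hp, hq, e⟩ => ⟨hp.symm, hq.symm, (key hp hq).2 e⟩⟩

open TwoCat in
theorem existsUnique_of_isComma {A B C T X : K} {j : A ⟶ B} {f : C ⟶ B} {p : T ⟶ A} {q : T ⟶ C}
    {κ : VCell (p ≫ j) (q ≫ f)}
    (hκ : IsComma (Vert.hom j) (Vert.hom f) (Vert.hom p) (Vert.hom q) (Vert.cell (K := K) κ))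
    {p' : X ⟶ A} {q' : X ⟶ C} (κ' : VCell (p' ≫ j) (q' ≫ f)) :
    ∃! t : X ⟶ T, ∃ (hp : p' = t ≫ p) (hq : q' = t ≫ q),
      comp₁ (J := HTarget.empty T) κ (vid t) (by rw [hp, Category.assoc])
        (by rw [hq, Category.assoc]) = κ' := by
  obtain ⟨t, ht, ut⟩ := hκ.one_dim (Vert.hom p') (Vert.hom q') (Vert.cell (K := K) κ')
  exact ⟨t, (isComma_one_dim_iff κ κ' t).1 ht, fun s hs => ut s ((isComma_one_dim_iff κ κ' s).2 hs)⟩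

open TwoCat Bicategory in
-- The associators of `V(K)` are absorbed into the boundaries of the composites `κ ∘ y` and `κ ∘ z`,
-- leaving an equation between horizontal composites of `K` that can be compared with the
-- compatibility condition of a tabulation.
theorem isComma_two_dim_iff {A B C T X : K} {j : A ⟶ B} {f : C ⟶ B} {p : T ⟶ A} {q : T ⟶ C}
    (κ : VCell (p ≫ j) (q ≫ f)) (y z : X ⟶ T) (ξ : VCell (y ≫ p) (z ≫ p))
    (ζ : VCell (y ≫ q) (z ≫ q)) :
    ((Vert.cell (K := K) ξ : Vert.hom y ≫ Vert.hom p ⟶ Vert.hom z ≫ Vert.hom p) ▷ Vert.hom j ≫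
        (α_ (Vert.hom z) (Vert.hom p) (Vert.hom j)).hom ≫
        Vert.hom z ◁ (Vert.cell (K := K) κ) ≫ (α_ (Vert.hom z) (Vert.hom q) (Vert.hom f)).inv =
      (α_ (Vert.hom y) (Vert.hom p) (Vert.hom j)).hom ≫ Vert.hom y ◁ (Vert.cell (K := K) κ) ≫
        (α_ (Vert.hom y) (Vert.hom q) (Vert.hom f)).inv ≫
        (Vert.cell (K := K) ζ : Vert.hom y ≫ Vert.hom q ⟶ Vert.hom z ≫ Vert.hom q) ▷
          Vert.hom f) ↔
    VCell.trans (VCell.whiskerRight ξ j) (comp₁ (J := HTarget.empty T) κ (vid z)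
        (Category.assoc z p j) (Category.assoc z q f)) =
      VCell.trans (comp₁ (J := HTarget.empty T) κ (vid y)
        (Category.assoc y p j) (Category.assoc y q f)) (VCell.whiskerRight ζ f) := by
  have e (t : X ⟶ T) : (α_ (Vert.hom t) (Vert.hom p) (Vert.hom j)).hom ≫
      Vert.hom t ◁ (Vert.cell (K := K) κ) ≫ (α_ (Vert.hom t) (Vert.hom q) (Vert.hom f)).inv =
        comp₁ (J := HTarget.empty T) κ (vid t) (Category.assoc t p j) (Category.assoc t q f) :=
    eqToHom_comp₁ (X := Vert.of X) (Y := Vert.of B) κ (vid t) rfl rfl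
      (Vert.assoc (Vert.hom t) (Vert.hom p) (Vert.hom j))
      (Vert.assoc (Vert.hom t) (Vert.hom q) (Vert.hom f)).symm
  have e₁ := congrArg ((Vert.cell (K := K) ξ : Vert.hom y ≫ Vert.hom p ⟶ Vert.hom z ≫ Vert.hom p) ▷
    Vert.hom j ≫ ·) (e z)
  have e₂ := congrArg (· ≫ (Vert.cell (K := K) ζ :
    Vert.hom y ≫ Vert.hom q ⟶ Vert.hom z ≫ Vert.hom q) ▷ Vert.hom f) (e y)
  have e₃ := ((Category.assoc _ _ _).trans (congrArg _ (Category.assoc _ _ _))).symm.trans e₂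
  exact Eq.congr e₁ e₃

/-- Interchange turns `χ ∘ (ξ ⊙ (π ∘ z))` into `(j ∘ ξ) ⊙ (χ ∘ π ∘ z)`, and similarly for `ζ`. Thus
the comma compatibility condition is the tabulation condition composed with `χ`, and for cartesian
`χ` it may be cancelled. -/
theorem comp₁_hcomp_eq_of_trans_eq {A B C T X : K} {j : A ⟶ B} {f : C ⟶ B} {R : Hor A C}
    (χ : Cell j f (HPath.single R) (HTarget.empty B)) {p : T ⟶ A} {q : T ⟶ C}
    (π : Cell p q (HPath.nil T) (HTarget.single R)) (y z : X ⟶ T) (ξ : VCell (y ≫ p) (z ≫ p))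
    (ζ : VCell (y ≫ q) (z ≫ q))
    (h : VCell.trans (VCell.whiskerRight ξ j) (comp₁ (J := HTarget.empty T)
        (comp₁ (J := HTarget.single R) χ π) (vid z) (Category.assoc z p j) (Category.assoc z q f)) =
      VCell.trans (comp₁ (J := HTarget.empty T) (comp₁ (J := HTarget.single R) χ π) (vid y)
        (Category.assoc y p j) (Category.assoc y q f)) (VCell.whiskerRight ζ f)) :
    comp₁ (J := HTarget.single R) χ (hcomp (L := HTarget.single R) ξ
        (comp₁ (J := HTarget.empty T) π (vid z)) rfl rfl) =
      comp₁ (J := HTarget.single R) χ (hcomp (L := HTarget.single R)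
        (comp₁ (J := HTarget.empty T) π (vid y)) ζ rfl rfl) := by
  have assoc (t : X ⟶ T) :
      comp₁ (J := HTarget.single R) χ (comp₁ (J := HTarget.empty T) π (vid t)) =
        comp₁ (J := HTarget.empty T) (comp₁ (J := HTarget.single R) χ π) (vid t)
          (Category.assoc t p j) (Category.assoc t q f) :=
    comp₁_comp_path (J := HTarget.single R) _ _ _ _ _ _ _ _ _ _ _
  have e₁ := hcomp_vid_comp₁_comp₁ (J := HTarget.single R) χ ξ
    (comp₁ (J := HTarget.empty T) π (vid z)) rfl rfl rfl
  have e₂ := hcomp_comp₁_vid_comp₁ χ (comp₁ (J := HTarget.empty T) π (vid y)) ζ rfl rfl rfl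
  have e₃ := comp₁_hcomp (L := HTarget.single R) χ ξ
    (comp₁ (J := HTarget.empty T) π (vid z)) rfl rfl rfl rfl
  have e₄ := comp₁_hcomp (L := HTarget.single R) χ
    (comp₁ (J := HTarget.empty T) π (vid y)) ζ rfl rfl rfl rfl
  refine e₃.trans (e₁.symm.trans (Eq.trans ?_ (e₂.trans e₄.symm)))
  exact (congrArg (VCell.trans (VCell.whiskerRight ξ j)) (assoc z)).trans
    (h.trans (congrArg (VCell.trans · (VCell.whiskerRight ζ f)) (assoc y).symm))

open TwoCat Bicategory in
/-- If `χ : R ⇒ B` defines `R` as the restriction `B(j, f)` then the tabulation of `R` is the comma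
object `j / f`. -/
theorem IsTabulation.isComma {A B C T : K} {j : A ⟶ B} {f : C ⟶ B} {R : Hor A C}
    {χ : Cell j f (HPath.single R) (HTarget.empty B)} (hχ : IsCartesian (J := HTarget.single R) χ)
    {p : T ⟶ A} {q : T ⟶ C} {π : Cell p q (HPath.nil T) (HTarget.single R)} (hπ : IsTabulation π) :
    IsComma (Vert.hom j) (Vert.hom f) (Vert.hom p) (Vert.hom q)
      (Vert.cell (K := K) (comp₁ (J := HTarget.single R) χ π)) := by
  have assoc {X : K} (t : X ⟶ T) {p' : X ⟶ A} {q' : X ⟶ C} (hp : p' = t ≫ p) (hq : q' = t ≫ q) :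
      comp₁ (J := HTarget.single R) χ (comp₁ (J := HTarget.empty T) π (vid t) hp hq) =
        comp₁ (J := HTarget.empty T) (comp₁ (J := HTarget.single R) χ π) (vid t)
          (by rw [hp, Category.assoc]) (by rw [hq, Category.assoc]) :=
    comp₁_comp_path (J := HTarget.single R) _ _ _ _ _ _ _ _ _ _ _
  constructor
  · intro X p' q' κ'
    -- Two bijections are composed: vertical cells `κ'` correspond to cells `ρ` into `R` because `χ`
    -- is cartesian, and these to morphisms into `T` by tabulation.
    obtain ⟨ρ, hρ, uρ⟩ := hχ (X := X.obj) (Y := X.obj) p' q' _ _ rfl rfl (HPath.nil X) κ'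
    obtain ⟨t, ⟨hp, hq, ht⟩, ut⟩ := hπ.one_dim (X := X.obj) p' q' ρ
    refine ⟨t, (isComma_one_dim_iff (X := X.obj) (comp₁ (J := HTarget.single R) χ π) κ' t).2
      ⟨hp, hq, ?_⟩, fun s hs => ut s ?_⟩
    · exact (assoc t hp hq).symm.trans ((congrArg (comp₁ (J := HTarget.single R) χ ·) ht).trans hρ)
    · obtain ⟨hp, hq, hs⟩ :=
        (isComma_one_dim_iff (X := X.obj) (comp₁ (J := HTarget.single R) χ π) κ' s).1 hs
      exact ⟨hp, hq, uρ _ ((assoc s hp hq).trans hs)⟩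
  · intro X y z ξ ζ h
    refine hπ.two_dim (X := X.obj) (Y := X.obj) y z (HPath.nil X) ξ ζ ?_
    refine (hχ (X := X.obj) (Y := X.obj) _ _ _ _ rfl rfl (HPath.nil X) _).unique ?_ rfl
    exact comp₁_hcomp_eq_of_trans_eq (X := X.obj) χ π y z ξ ζ
      ((isComma_two_dim_iff (X := X.obj) (comp₁ (J := HTarget.single R) χ π) y z ξ ζ).1 h)

/-- Any comma cell factors through a tabulation by an isomorphism. -/
theorem isWeaklyNullaryCocartesian_of_isComma {A B C T T' : K} {j : A ⟶ B} {f : C ⟶ B} {R : Hor A C}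
    {χ : Cell j f (HPath.single R) (HTarget.empty B)} (hχ : IsCartesian (J := HTarget.single R) χ)
    {p : T ⟶ A} {q : T ⟶ C} {π : Cell p q (HPath.nil T) (HTarget.single R)} (hπ : IsTabulation π)
    (hπ' : IsWeaklyNullaryCocartesian (CellPath.single π)) {p' : T' ⟶ A} {q' : T' ⟶ C}
    {ρ : Cell p' q' (HPath.nil T') (HTarget.single R)}
    (hρ : TwoCat.IsComma (Vert.hom j) (Vert.hom f) (Vert.hom p') (Vert.hom q')
      (Vert.cell (K := K) (comp₁ (J := HTarget.single R) χ ρ))) :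
    IsWeaklyNullaryCocartesian (CellPath.single ρ) := by
  have assoc {X Y : K} {p : Y ⟶ A} {q : Y ⟶ C} (π : Cell p q (HPath.nil Y) (HTarget.single R))
      (t : X ⟶ Y) {p' : X ⟶ A} {q' : X ⟶ C} (hp : p' = t ≫ p) (hq : q' = t ≫ q) :
      comp₁ (J := HTarget.single R) χ (comp₁ (J := HTarget.empty Y) π (vid t) hp hq) =
        comp₁ (J := HTarget.empty Y) (comp₁ (J := HTarget.single R) χ π) (vid t)
          (by rw [hp, Category.assoc]) (by rw [hq, Category.assoc]) :=
    comp₁_comp_path (J := HTarget.single R) _ _ _ _ _ _ _ _ _ _ _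
  -- Each of `ρ` and `π` factors through the other: `ρ = π ∘ s` and, after cancelling `χ`, `π = ρ ∘
  -- t`. Uniqueness of the factorisations makes `s` and `t` mutually inverse.
  obtain ⟨s, ⟨hp, hq, hs⟩, -⟩ := hπ.one_dim p' q' ρ
  obtain ⟨t, ⟨hp₁, hq₁, ht₁⟩, -⟩ := existsUnique_of_isComma hρ (comp₁ (J := HTarget.single R) χ π)
  have ht : comp₁ (J := HTarget.empty T') ρ (vid t) hp₁ hq₁ = π :=
    (hχ p q _ _ rfl rfl (HPath.nil T) (comp₁ (J := HTarget.single R) χ π)).unique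
      ((assoc ρ t hp₁ hq₁).trans ht₁) rfl
  have hts : t ≫ s = 𝟙 T := by
    refine (hπ.one_dim p q π).unique ⟨by rw [Category.assoc, ← hp, hp₁],
      by rw [Category.assoc, ← hq, hq₁], ?_⟩ ⟨(Category.id_comp _).symm, (Category.id_comp _).symm,
        comp₁_tid (J := HTarget.empty T) π⟩
    have e := comp₁_vid_comp₁_vid π t s rfl hp₁ hq₁ hp hq (by rw [Category.assoc, ← hp, hp₁])
      (by rw [Category.assoc, ← hq, hq₁])
    exact e.symm.trans ((congrArg (comp₁ (J := HTarget.empty T') · (vid t) hp₁ hq₁) hs).trans ht)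
  have hst : s ≫ t = 𝟙 T' := by
    have e₁ := comp₁_vid_comp₁_vid ρ s t rfl hp hq hp₁ hq₁ (by rw [Category.assoc, ← hp₁, hp])
      (by rw [Category.assoc, ← hq₁, hq])
    have e₂ := e₁.symm.trans ((congrArg (comp₁ (J := HTarget.empty T) · (vid s) hp hq) ht).trans hs)
    refine (existsUnique_of_isComma hρ (comp₁ (J := HTarget.single R) χ ρ)).unique
      ⟨by rw [Category.assoc, ← hp₁, hp], by rw [Category.assoc, ← hq₁, hq], ?_⟩
      ⟨(Category.id_comp _).symm, (Category.id_comp _).symm, ?_⟩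
    · exact (assoc ρ (s ≫ t) _ _).symm.trans (congrArg (comp₁ (J := HTarget.single R) χ ·) e₂)
    · exact comp₁_tid (J := HTarget.empty T') _
  intro N h k ω
  have key (γ : Cell h k (HPath.single R) (HTarget.empty N)) :
      comp₁ (J := HTarget.single R) γ ρ =
        comp₁ (J := HTarget.empty T) (comp₁ (J := HTarget.single R) γ π) (vid s)
          (by rw [hp, Category.assoc]) (by rw [hq, Category.assoc]) :=
    (congrArg (comp₁ (J := HTarget.single R) γ ·) hs).symm.trans
      (comp₁_comp_path (J := HTarget.single R) _ _ _ _ _ _ _ _ _ _ _)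
  have key' (γ : Cell h k (HPath.single R) (HTarget.empty N)) :
      comp₁ (J := HTarget.single R) γ π =
        comp₁ (J := HTarget.empty T') (comp₁ (J := HTarget.single R) γ ρ) (vid t)
          (by rw [hp₁, Category.assoc]) (by rw [hq₁, Category.assoc]) :=
    (congrArg (comp₁ (J := HTarget.single R) γ ·) ht).symm.trans
      (comp₁_comp_path (J := HTarget.single R) _ _ _ _ _ _ _ _ _ _ _)
  -- Transport `ω` to `T` along `t`, factor it there through `π`, and return along `s`.
  obtain ⟨γ, hγ, uγ⟩ := hπ' h k (comp₁ (J := HTarget.empty T') ω (vid t)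
    (by rw [hp₁, Category.assoc]) (by rw [hq₁, Category.assoc]))
  refine ⟨γ, ?_, fun δ hδ => uγ δ ((key' δ).trans
    (congrArg (comp₁ (J := HTarget.empty T') · (vid t) _ _) hδ))⟩
  refine (key γ).trans ((congrArg (comp₁ (J := HTarget.empty T) · (vid s) _ _) hγ).trans ?_)
  refine (comp₁_vid_comp₁_vid ω s t hst.symm _ _ _ _ (Category.id_comp _).symm
    (Category.id_comp _).symm).trans ?_
  exact comp₁_tid (J := HTarget.empty T') ω

/-! ### Street's condition in terms of restrictions of the nullary cell. -/

open Bicategory in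
-- A Kan extension is an initial object of the category of left extensions, whose morphisms are
-- cells compatible with the units; the right-hand side is initiality spelled out.
theorem nonempty_isKan_iff {𝓑 : Type u} [Bicategory.{w, v} 𝓑] {a b c : 𝓑} {f : a ⟶ b} {g : a ⟶ c}
    (e : b ⟶ c) (η : g ⟶ f ≫ e) :
    Nonempty (LeftExtension.IsKan (LeftExtension.mk e η)) ↔
      ∀ (k : b ⟶ c) (φ : g ⟶ f ≫ k), ∃! φ' : e ⟶ k, η ≫ f ◁ φ' = φ := by
  refine ⟨fun ⟨h⟩ k φ => ⟨h.desc (LeftExtension.mk k φ), h.fac _, fun γ hγ => h.hom_ext ?_⟩,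
    fun h => ⟨.mk (fun s => LeftExtension.homMk (h s.extension s.unit).choose
      (h s.extension s.unit).choose_spec.1) fun s τ => ?_⟩⟩
  · exact hγ.trans (h.fac (LeftExtension.mk k φ)).symm
  · ext
    exact (h s.extension s.unit).unique (LeftExtension.w τ) (h s.extension s.unit).choose_spec.1

open TwoCat Bicategory in
/-- The pasting of `η' ∘ cocart` with the comma cell that corresponds to `ρ : T ⇒ j_*(id, f)` is the
composite of `ρ` with the restriction of `η'`. -/
theorem Companion.pasting_eq {A B M C T : K} {j : A ⟶ B} {d : A ⟶ M} {l : B ⟶ M}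
    (c : Companion j) (η' : Cell d l (HPath.single c.hor) (HTarget.empty M)) {f : C ⟶ B}
    {R : Hor A C} (cart : Cell (𝟙 A) f (HPath.single R) (HTarget.single c.hor)) {p : T ⟶ A}
    {q : T ⟶ C} (ρ : Cell p q (HPath.nil T) (HTarget.single R)) :
    (Vert.hom p ◁ (Vert.cell (K := K) (comp₁ (J := HTarget.single c.hor) η' c.cocart
          (Category.id_comp d).symm rfl) : Vert.hom d ⟶ Vert.hom j ≫ Vert.hom l) ≫
        (α_ (Vert.hom p) (Vert.hom j) (Vert.hom l)).inv ≫
        (Vert.cell (K := K) (comp₁ (J := HTarget.single R) (comp₁ (J := HTarget.single c.hor) c.cart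
          cart (Category.id_comp j).symm (Category.comp_id f).symm) ρ) :
            Vert.hom p ≫ Vert.hom j ⟶ Vert.hom q ≫ Vert.hom f) ▷ Vert.hom l ≫
        (α_ (Vert.hom q) (Vert.hom f) (Vert.hom l)).hom :
          Vert.hom p ≫ Vert.hom d ⟶ Vert.hom q ≫ Vert.hom f ≫ Vert.hom l) =
      comp₁ (J := HTarget.single R) (restrict (P := HPath.nil A) η' cart) ρ := by
  have e₁ := eqToHom_comp₁ (X := Vert.of T) (Y := Vert.of M) (vid l)
    (comp₁ (J := HTarget.single R) (comp₁ (J := HTarget.single c.hor) c.cart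
          cart (Category.id_comp j).symm (Category.comp_id f).symm) ρ) rfl rfl
    (Vert.assoc (Vert.hom p) (Vert.hom j) (Vert.hom l)).symm
    (Vert.assoc (Vert.hom q) (Vert.hom f) (Vert.hom l))
  have e₂ := comp₁_comp_path (J := HTarget.single c.hor) c.cart cart
    (CellPath.single (L := HTarget.single R) ρ) rfl (Category.comp_id (q ≫ f)).symm
    (Category.comp_id p).symm rfl rfl rfl (Category.id_comp j).symm (Category.comp_id f).symm
  -- The recovery of `η'` from `η' ∘ cocart` is applied to the cell `cart ∘ ρ` into `j_*`; the
  -- remaining equations only reassociate.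
  have e₃ := c.hcomp_whisker η' (comp₁ (J := HTarget.single R) cart ρ (Category.comp_id p).symm rfl)
    (a := p ≫ d) (b := p ≫ j ≫ l) (e := q ≫ f ≫ l) rfl rfl (Category.assoc p j l).symm
    (Category.assoc q f l).symm (Category.assoc q f l).symm rfl (Category.comp_id (q ≫ f)).symm
  have e₄ := comp₁_comp_path (J := HTarget.single c.hor) η' cart
    (CellPath.single (L := HTarget.single R) ρ) (a := p ≫ d) (b := q ≫ f ≫ l) rfl
    (Category.assoc q f l).symm (Category.comp_id p).symm rfl rfl rfl (Category.id_comp d).symm rfl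
  refine (congrArg (_ ≫ ·) e₁).trans (Eq.trans ?_ (e₃.trans e₄))
  exact congrArg (fun t => hcomp _ (comp₁ (J := HTarget.empty B) (vid l) t
    (Category.assoc p j l).symm (Category.assoc q f l).symm) rfl rfl) e₂.symm

/-- Street's condition at the comma object that corresponds to `ρ : T ⇒ j_*(id, f)`. -/
theorem Companion.nonempty_isKan_iff {A B M C T : K} {j : A ⟶ B} {d : A ⟶ M} {l : B ⟶ M}
    (c : Companion j) (η' : Cell d l (HPath.single c.hor) (HTarget.empty M)) {f : C ⟶ B}
    {R : Hor A C} (cart : Cell (𝟙 A) f (HPath.single R) (HTarget.single c.hor)) {p : T ⟶ A}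
    {q : T ⟶ C} {ρ : Cell p q (HPath.nil T) (HTarget.single R)}
    (hρ : IsWeaklyNullaryCocartesian (CellPath.single ρ))
    {u : Vert.hom p ≫ Vert.hom d ⟶ Vert.hom q ≫ Vert.hom f ≫ Vert.hom l}
    (hu : u = comp₁ (J := HTarget.single R) (restrict (P := HPath.nil A) η' cart) ρ) :
    Nonempty (Bicategory.LeftExtension.IsKan (f := Vert.hom q) (g := Vert.hom p ≫ Vert.hom d)
        (Bicategory.LeftExtension.mk (Vert.hom f ≫ Vert.hom l) u)) ↔
      IsLeftKanAt (restrict (P := HPath.nil A) η' cart) (HPath.nil C) := by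
  subst hu
  exact (AVDC.nonempty_isKan_iff _ _).trans (isLeftKanAt_nil_iff hρ _).symm

end AVDC

/-! ### The comparison theorem. -/

open AVDC in
theorem mainTheorem7 {K : Type u} [AugVirtualDoubleCategory.{u, v, w, x} K]
    (hR : HasRightRestrictions K) (hT : HasLeftNullaryCocartesianTabulations K)
    {A B M : K} (j : A ⟶ B) (d : A ⟶ M) (l : B ⟶ M) (c : Companion j)
    (η : VCell d (j ≫ l)) (η' : Cell d l (HPath.single c.hor) (HTarget.empty M))
    (hη : η = comp₁ (J := HTarget.single c.hor) η' c.cocart (Category.id_comp d).symm rfl) :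
    TwoCat.IsPointwiseLeftKan (Vert.hom j) (Vert.hom d) (Vert.hom l) (Vert.cell η) ↔
      IsPointwiseLeftKan (P := HPath.nil A) η' := by
  subst hη
  rw [isPointwiseLeftKan_iff hR hT]
  constructor
  · intro h Y f R cart hc
    -- Street's condition is tested only on the comma object given by the tabulation of `R`.
    obtain ⟨T, πA, πB, π, hπ, hπ', -⟩ := hT R
    have hχ := c.isCartesian.comp₁ (L := HTarget.single c.hor) (J := HTarget.single R) hc
      (Category.id_comp j).symm (Category.comp_id f).symm
    exact (c.nonempty_isKan_iff η' cart hπ' (c.pasting_eq η' cart π)).1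
      (h (Vert.hom f) (Vert.hom πA) (Vert.hom πB) _ (hπ.isComma hχ))
  · intro h C f T p q κ hκ
    change C.obj ⟶ B at f
    change T.obj ⟶ A at p
    change T.obj ⟶ C.obj at q
    obtain ⟨R, cart, hc⟩ := hR c.hor f
    have hχ := c.isCartesian.comp₁ (L := HTarget.single c.hor) (J := HTarget.single R) hc
      (Category.id_comp j).symm (Category.comp_id f).symm
    obtain ⟨S, πA, πB, π, hπ, hπ', -⟩ := hT R
    -- An arbitrary comma cell corresponds to a cell `ρ` into `R`; comparison with the tabulation
    -- makes `ρ` weakly nullary-cocartesian.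
    obtain ⟨ρ, rfl, -⟩ := hχ p q _ _ rfl rfl (HPath.nil T.obj) κ
    exact (c.nonempty_isKan_iff η' cart (isWeaklyNullaryCocartesian_of_isComma hχ hπ hπ' hκ)
      (c.pasting_eq η' cart ρ)).2 (h f R cart hc)
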